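/- **Setting.** Let $H$ be a real separable Hilbert space with orthonormal basis $\{h_k\}_{k\ge1}$, and let $X$ be a real separable Hilbert space into which $H$ is densely, continuously and injectively embedded with $\sum_{k}\|h_k\|_X^2<\infty$. Let $(\Omega,\mathcal F,(\mathcal F_t)_{t\ge0},\mathbb P)$ be a stochastic basis satisfying the usual conditions, with independent standard $(\mathcal F_t)$-Brownian motions $w_k$, $k\ge1$. Let $T>0$, let $\Theta_1,\Theta_2\subset\mathbb R$ be compact, let $\theta_1\in\Theta_1$, $\theta_2\in\Theta_2$, and let $\mathcal A_0,\mathcal A_1,\mathcal B_0,\mathcal B_1$ be (possibly unbounded) linear operators on $H$. Consider $$\ddot u+(\mathcal A_0+\theta_1\mathcal A_1)u=(\mathcal B_0+\theta_2\mathcal B_1)\dot u+\dot W,\quad 0<t\le T,\qquad u(0)=\dot u(0)=0,\qquad W(t)=\sum_k w_k(t)h_k .$$ Assume the equation is *diagonalizable*: $\mathcal A_0h_k=\kappa_kh_k$, $\mathcal A_1h_k=\tau_kh_k$, $\mathcal B_0h_k=\rho_kh_k$, $\mathcal B_1h_k=\nu_kh_k$ for all $k$ (with real eigenvalues); and *hyperbolic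 on $[0,T]$*: (1) there are $C^*,c_1,c_2>0$ such that for every $\theta\in\Theta_1$ the sequence $\{\kappa_k+\theta\tau_k+C^*\}_k$ is positive, non-decreasing and unbounded, and $c_1\le\frac{\kappa_k+\theta\tau_k+C^*}{\kappa_k+\theta'\tau_k+C^*}\le c_2$ for all $k$ and all $\theta,\theta'\in\Theta_1$; (2) there are $C,J>0$ such that $T(\rho_k+\vartheta_2\nu_k)\le\ln(\kappa_k+\vartheta_1\tau_k)+C$ for all $k\ge J$, $\vartheta_1\in\Theta_1$, $\vartheta_2\in\Theta_2$. Put $\lambda_k=\kappa_k+\theta_1\tau_k$ and $\mu_k=\rho_k+\theta_2\nu_k$. A *generalized solution* is an adapted $X$-valued process $u=(u(t))_{0\le t\le T}$ such that, for each $t\in[0,T]$, $u(t)=\sum_k u_k(t)h_k$ with convergence in $X$ in probability, where each $u_k$ is an adapted solution on $[0,T]$ of $\ddot u_k-\mu_k\dot u_k+\lambda_ku_k=\dot w_k$, $u_k(0)=\dot u_k(0)=0$. The latter means that there is an adapted, almost surely continuous process $v_k=\dot u_k$ such that, almost surely, for all $t\in[0,T]$, $u_k(t)=\int_0^tv_k(s)\,ds$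 and $v_k(t)=\int_0^t\big(\mu_kv_k(s)-\lambda_ku_k(s)\big)ds+w_k(t)$. **Theorem 2.1.** 1. (Existence.) There is a generalized solution $u$ such that, for every $t\in[0,T]$, $\mathbb E\|u(t)\|_X^2<\infty$ and the series $\sum_ku_k(t)h_k$ converges to $u(t)$ also in mean square in $X$. 2. (Uniqueness.) If $u$ and $u'$ are generalized solutions with coefficients $u_k$ and $u'_k$, then $u(t)=u'(t)$ almost surely for every $t\in[0,T]$; moreover, for each $k$, almost surely $u_k(t)=u_k'(t)$ for all $t\in[0,T]$. 3. (Velocity.) If, in addition, there is $C_0\in\mathbb R$ with $\mu_k=\rho_k+\theta_2\nu_k\le C_0$ for all $k$, then $v=\dot u$ is an $X$-valued process: for every generalized solution $u$ there is an adapted $X$-valued process $v$ on $[0,T]$ such that, for every $t\in[0,T]$, $\mathbb E\|v(t)\|_X^2<\infty$, $v(t)=\sum_k\dot u_k(t)h_k$ with convergence in mean square in $X$, and $v(t)$ is the mean-square derivative of $u$ at $t$ (one-sided at $t=0$ and $t=T$): $$\mathbb E\Big\|\frac{u(s)-u(t)}{s-t}-v(t)\Big\|_X^2\to0\qquad\text{as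 } s\to t,\ s\in[0,T]\setminus\{t\}.$$ -/

import Mathlib

open MeasureTheory ProbabilityTheory Filter Set
open scoped NNReal ENNReal Topology

namespace StochHyp

/-- The operators `A₀, A₁, B₀, B₁` (linear, possibly unbounded, each with its own domain) have
`h` as a common system of eigenfunctions, with eigenvalues `κ, τ, ρ, ν` respectively. -/
structure IsDiagonalizable {H : Type*} [NormedAddCommGroup H] [InnerProductSpace ℝ H]
    (h : HilbertBasis ℕ ℝ H) (A₀ A₁ B₀ B₁ : H →ₗ.[ℝ] H) (κ τ ρ ν : ℕ → ℝ) : Prop where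
  eigen_A₀ : ∀ k, ∃ hk : h k ∈ A₀.domain, A₀ ⟨h k, hk⟩ = κ k • h k
  eigen_A₁ : ∀ k, ∃ hk : h k ∈ A₁.domain, A₁ ⟨h k, hk⟩ = τ k • h k
  eigen_B₀ : ∀ k, ∃ hk : h k ∈ B₀.domain, B₀ ⟨h k, hk⟩ = ρ k • h k
  eigen_B₁ : ∀ k, ∃ hk : h k ∈ B₁.domain, B₁ ⟨h k, hk⟩ = ν k • h k

/-- Hyperbolicity on `[0, T]`, for the parameter sets `Θ₁, Θ₂`. The first condition forces
`κ k + θ₁ * τ k → +∞` uniformly in `θ₁ ∈ Θ₁`, so the argument of the logarithm is positive for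
all large `k`; hence the value of `Real.log` at nonpositive numbers plays no role here. -/
structure IsHyperbolic (Θ₁ Θ₂ : Set ℝ) (T : ℝ) (κ τ ρ ν : ℕ → ℝ) : Prop where
  evolution : ∃ Cs c₁ c₂ : ℝ, 0 < Cs ∧ 0 < c₁ ∧ 0 < c₂ ∧
    (∀ θ ∈ Θ₁, (∀ k, 0 < κ k + θ * τ k + Cs) ∧
      Monotone (fun k => κ k + θ * τ k + Cs) ∧
      ¬ BddAbove (range fun k => κ k + θ * τ k + Cs)) ∧
    ∀ θ ∈ Θ₁, ∀ θ' ∈ Θ₁, ∀ k,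
      c₁ ≤ (κ k + θ * τ k + Cs) / (κ k + θ' * τ k + Cs) ∧
      (κ k + θ * τ k + Cs) / (κ k + θ' * τ k + Cs) ≤ c₂
  dissipation : ∃ C : ℝ, 0 < C ∧ ∃ J : ℕ, ∀ k, J ≤ k → ∀ θ₁ ∈ Θ₁, ∀ θ₂ ∈ Θ₂,
    T * (ρ k + θ₂ * ν k) ≤ Real.log (κ k + θ₁ * τ k) + C

variable {Ω : Type*} {mΩ : MeasurableSpace Ω}

/-- The usual conditions on a filtration: right-continuity, and all `P`-null sets
(in particular, all subsets of measurable null sets) belong to `F 0`. -/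
structure UsualConditions (F : Filtration ℝ≥0 mΩ) (P : Measure Ω) : Prop where
  right_continuous : F.IsRightContinuous
  complete : ∀ s : Set Ω, P s = 0 → MeasurableSet[F 0] s

/-- A sequence of independent standard Brownian motions on the stochastic basis `(Ω, F, P)`. -/
structure IsIndepBrownian (F : Filtration ℝ≥0 mΩ) (P : Measure Ω) (w : ℕ → ℝ≥0 → Ω → ℝ) :
    Prop where
  brownian : ∀ k, IsBrownianReal (w k) P
  adapted : ∀ k, StronglyAdapted F (w k)
  indep_past : ∀ k, ∀ s t : ℝ≥0, s ≤ t →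
    Indep (MeasurableSpace.comap (fun ω => w k t ω - w k s ω) inferInstance) (F s) P
  indep : iIndepFun (fun k ω t => w k t ω) P

/-- `(x, v)` is an adapted solution on `[0, T]` of the damped stochastic oscillator
`x'' - μ x' + lam x = w'`, `x(0) = x'(0) = 0`, with `v = x'`: almost surely `v` is continuous and,
for all `t ∈ [0, T]`, `x(t) = ∫₀ᵗ v(s) ds` and `v(t) = ∫₀ᵗ (μ v(s) - lam x(s)) ds + w(t)`. -/
structure IsDampedOscillator (F : Filtration ℝ≥0 mΩ) (P : Measure Ω) (T : ℝ≥0)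
    (w : ℝ≥0 → Ω → ℝ) (μ lam : ℝ) (x v : ℝ≥0 → Ω → ℝ) : Prop where
  adapted_position : ∀ t ≤ T, StronglyMeasurable[F t] (x t)
  adapted_velocity : ∀ t ≤ T, StronglyMeasurable[F t] (v t)
  continuous_velocity : ∀ᵐ ω ∂P, ContinuousOn (fun t => v t ω) (Iic T)
  position_eq : ∀ᵐ ω ∂P, ∀ t ≤ T, x t ω = ∫ s in (0 : ℝ)..t, v s.toNNReal ω
  velocity_eq : ∀ᵐ ω ∂P, ∀ t ≤ T,
    v t ω = (∫ s in (0 : ℝ)..t, (μ * v s.toNNReal ω - lam * x s.toNNReal ω)) + w t ω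

variable {X : Type*} [NormedAddCommGroup X] [InnerProductSpace ℝ X]

/-- Partial sums of the random series `∑ₖ a k t • e k`. -/
def partialSum (e : ℕ → X) (a : ℕ → ℝ≥0 → Ω → ℝ) (n : ℕ) (t : ℝ≥0) (ω : Ω) : X :=
  ∑ k ∈ Finset.range n, a k t ω • e k

/-- `y(t) = ∑ₖ a k t • e k` for every `t ∈ [0, T]`, as square-integrable random elements of `X`:
`E ‖y(t)‖² < ∞` and the series converges in mean square. -/
def IsMeanSquareSum (P : Measure Ω) (T : ℝ≥0) (e : ℕ → X) (a : ℕ → ℝ≥0 → Ω → ℝ)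
    (y : ℝ≥0 → Ω → X) : Prop :=
  ∀ t ≤ T, MemLp (y t) 2 P ∧
    Tendsto (fun n => eLpNorm (fun ω => partialSum e a n t ω - y t ω) 2 P) atTop (𝓝 0)

/-- `u` is an adapted `X`-valued process on `[0, T]` with `u(t) = ∑ₖ x k t • e k`, the series
converging in `X` in probability for each `t`, where `x k` solves the oscillator equation with
coefficients `μ k`, `lam k`, driven by `w k`, with zero initial data, and `v k` is the time
derivative of `x k`. -/
structure IsGeneralizedSolution (F : Filtration ℝ≥0 mΩ) (P : Measure Ω) (T : ℝ≥0)
    (w : ℕ → ℝ≥0 → Ω → ℝ) (e : ℕ → X) (μ lam : ℕ → ℝ)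
    (u : ℝ≥0 → Ω → X) (x v : ℕ → ℝ≥0 → Ω → ℝ) : Prop where
  adapted : ∀ t ≤ T, StronglyMeasurable[F t] (u t)
  oscillator : ∀ k, IsDampedOscillator F P T (w k) (μ k) (lam k) (x k) (v k)
  expansion : ∀ t ≤ T, TendstoInMeasure P (fun n => partialSum e x n t) atTop (u t)

/-- `y` is the mean-square time derivative of `u` on `[0, T]` (one-sided at the end points). -/
def IsMeanSquareDeriv (P : Measure Ω) (T : ℝ≥0) (u y : ℝ≥0 → Ω → X) : Prop :=
  ∀ t ≤ T, Tendsto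
    (fun s : ℝ≥0 => eLpNorm (fun ω => ((s : ℝ) - (t : ℝ))⁻¹ • (u s ω - u t ω) - y t ω) 2 P)
    (𝓝[Iic T \ {t}] t) (𝓝 0)

end StochHyp

/-! The problem splits into scalar oscillators, one per mode, and what is needed is a bound uniform
in the mode. Let f solve f'' = μ f' - λ f, f(0) = 0, f'(0) = 1. The k-th coefficient has to be ∫₀ᵗ
f_k(t - s) dw_k(s), and its velocity the same integral of f_k'. Since f is smooth, integration by
parts turns both into ordinary integrals of the path (`pathConv`). The equation can then be checked
path by path, and two solutions differ by a solution of the homogeneous linear system with zero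
data, hence by zero (`oscillator_eq_zero`). This gives uniqueness of the coefficients, and of the
process as a limit in probability.

The covariance min(s, r) of the noise gives the isometry E u_k(t)² = ∫₀ᵗ f_k(t - s)² ds
(`IsBrownianCov.integral_pathConv_sq`), so f_k² has to be bounded on [0, T] uniformly in k
(`exists_impulse_sq_bound`). If μ_k ≤ 0 this is decay of the energy f'² + λ f². If μ_k > 0, removing
the damping gives (λ - μ²/4) f² ≤ exp(μ t), and hyperbolicity yields both exp(μ_k t) ≤ λ_k exp C and
μ_k² ≤ 2 λ_k for large k. When the μ_k are bounded above, the energy also controls f_k'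
(`exists_impulseDeriv_sq_bound`).

Different modes are orthogonal in L²(Ω), so E‖∑ a_k h_k‖² = ∑ E a_k² ‖h_k‖², although the h_k need
not be orthogonal in X. Together with ∑ ‖h_k‖² < ∞, bounded second moments give mean-square
convergence. The same identity applied to the errors of the difference quotients, which are bounded
uniformly in k and tend to 0 for each k, gives the mean-square derivative by dominated convergence
over k. -/

namespace StochHyp

/-! ### Impulse response of the scalar oscillator -/

/-- The generator of the first-order system `x' = y`, `y' = μ y - lam x`. -/
noncomputable def oscillatorGenerator (μ lam : ℝ) : ℝ × ℝ →L[ℝ] ℝ × ℝ :=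
  (ContinuousLinearMap.snd ℝ ℝ ℝ).prod
    (μ • ContinuousLinearMap.snd ℝ ℝ ℝ - lam • ContinuousLinearMap.fst ℝ ℝ ℝ)

lemma oscillatorGenerator_apply (μ lam : ℝ) (p : ℝ × ℝ) :
    oscillatorGenerator μ lam p = (p.2, μ * p.2 - lam * p.1) := by
  simp [oscillatorGenerator]

/-- The flow of the first-order system. -/
noncomputable def oscillatorFlow (μ lam t : ℝ) : ℝ × ℝ →L[ℝ] ℝ × ℝ :=
  NormedSpace.exp (t • oscillatorGenerator μ lam)

/-- The impulse response: `f'' = μ f' - lam f`, `f 0 = 0`, `f' 0 = 1`. -/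
noncomputable def impulse (μ lam t : ℝ) : ℝ := (oscillatorFlow μ lam t (0, 1)).1

/-- The derivative of the impulse response. -/
noncomputable def impulseDeriv (μ lam t : ℝ) : ℝ := (oscillatorFlow μ lam t (0, 1)).2

/-- The second derivative of the impulse response. -/
noncomputable def impulseDeriv₂ (μ lam t : ℝ) : ℝ :=
  μ * impulseDeriv μ lam t - lam * impulse μ lam t

lemma hasDerivAt_oscillatorFlow (μ lam t : ℝ) :
    HasDerivAt (oscillatorFlow μ lam)
      (oscillatorGenerator μ lam * oscillatorFlow μ lam t) t :=
  hasDerivAt_exp_smul_const' (𝕂 := ℝ) (oscillatorGenerator μ lam) t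

lemma oscillatorFlow_add (μ lam s t : ℝ) :
    oscillatorFlow μ lam (s + t) = oscillatorFlow μ lam s * oscillatorFlow μ lam t := by
  rw [oscillatorFlow, add_smul]
  let _ : NormedAlgebra ℚ (ℝ × ℝ →L[ℝ] ℝ × ℝ) := NormedAlgebra.restrictScalars ℚ ℝ _
  exact NormedSpace.exp_add_of_commute (((Commute.refl _).smul_left s).smul_right t)

lemma oscillatorFlow_zero (μ lam : ℝ) : oscillatorFlow μ lam 0 = 1 := by
  simp [oscillatorFlow]

lemma hasDerivAt_oscillatorFlow_apply (μ lam t : ℝ) (p : ℝ × ℝ) :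
    HasDerivAt (fun s => oscillatorFlow μ lam s p)
      (oscillatorGenerator μ lam (oscillatorFlow μ lam t p)) t := by
  simpa using (hasDerivAt_oscillatorFlow μ lam t).clm_apply (hasDerivAt_const t p)

lemma hasDerivAt_impulse (μ lam t : ℝ) :
    HasDerivAt (impulse μ lam) (impulseDeriv μ lam t) t := by
  have h := (hasDerivAt_oscillatorFlow_apply μ lam t (0, 1)).fst
  rwa [oscillatorGenerator_apply] at h

lemma hasDerivAt_impulseDeriv (μ lam t : ℝ) :
    HasDerivAt (impulseDeriv μ lam) (impulseDeriv₂ μ lam t) t := by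
  have h := (hasDerivAt_oscillatorFlow_apply μ lam t (0, 1)).snd
  rwa [oscillatorGenerator_apply] at h

lemma impulse_zero (μ lam : ℝ) : impulse μ lam 0 = 0 := by
  simp [impulse, oscillatorFlow_zero]

lemma impulseDeriv_zero (μ lam : ℝ) : impulseDeriv μ lam 0 = 1 := by
  simp [impulseDeriv, oscillatorFlow_zero]

lemma continuous_impulse (μ lam : ℝ) : Continuous (impulse μ lam) :=
  continuous_iff_continuousAt.2 fun t => (hasDerivAt_impulse μ lam t).continuousAt

lemma continuous_impulseDeriv (μ lam : ℝ) : Continuous (impulseDeriv μ lam) :=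
  continuous_iff_continuousAt.2 fun t => (hasDerivAt_impulseDeriv μ lam t).continuousAt

lemma continuous_impulseDeriv₂ (μ lam : ℝ) : Continuous (impulseDeriv₂ μ lam) :=
  ((continuous_impulseDeriv μ lam).const_mul μ).sub ((continuous_impulse μ lam).const_mul lam)

/-- The vector (1, μ) is the generator applied to (0, 1), and the flow commutes with its generator.
Thus f' and f'' are the components of one orbit of the flow. -/
lemma oscillatorFlow_apply_forcing (μ lam t : ℝ) :
    oscillatorFlow μ lam t (1, μ) = (impulseDeriv μ lam t, impulseDeriv₂ μ lam t) := by
  have h1 := hasDerivAt_oscillatorFlow_apply μ lam t (0, 1)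
  have h2 : HasDerivAt (oscillatorFlow μ lam)
      (oscillatorFlow μ lam t * oscillatorGenerator μ lam) t :=
    hasDerivAt_exp_smul_const (𝕂 := ℝ) (oscillatorGenerator μ lam) t
  have h3 := h2.clm_apply (hasDerivAt_const t ((0 : ℝ), (1 : ℝ)))
  have h4 := h1.unique h3
  simp only [mul_apply_eq_comp, oscillatorGenerator_apply, map_zero, add_zero,
    mul_one, mul_zero, sub_zero] at h4
  exact h4.symm

/-! ### Variation of constants along a path, and uniqueness without forcing -/

/-- The convolution `g(0) b(t) + ∫₀ᵗ g'(t - s) b(s) ds`, that is, `∫₀ᵗ g(t - s) db(s)` after an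
integration by parts. -/
noncomputable def pathConv (g g' b : ℝ → ℝ) (t : ℝ) : ℝ :=
  g 0 * b t + ∫ s in (0 : ℝ)..t, g' (t - s) * b s

section Convolution

variable {b : ℝ → ℝ} (hb : Continuous b) (μ lam : ℝ)

include hb

/-- The group law Φ(t - s) = Φ(t) Φ(-s) moves t out of the integrand. The product rule and the
fundamental theorem of calculus then suffice, and no differentiation under the integral sign is
needed. -/
lemma hasDerivAt_conv_pair (t : ℝ) :
    HasDerivAt (fun t => ((∫ s in (0 : ℝ)..t, impulseDeriv μ lam (t - s) * b s),
        (∫ s in (0 : ℝ)..t, impulseDeriv₂ μ lam (t - s) * b s)))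
      ((∫ s in (0 : ℝ)..t, impulseDeriv₂ μ lam (t - s) * b s) + b t,
        μ * ((∫ s in (0 : ℝ)..t, impulseDeriv₂ μ lam (t - s) * b s) + b t)
          - lam * ∫ s in (0 : ℝ)..t, impulseDeriv μ lam (t - s) * b s) t := by
  have hc : Continuous fun s => oscillatorFlow μ lam (-s) (b s • ((1 : ℝ), μ)) := by
    have : Continuous (oscillatorFlow μ lam) :=
      continuous_iff_continuousAt.2 fun t => (hasDerivAt_oscillatorFlow μ lam t).continuousAt
    fun_prop
  have hp : ∀ t, ((∫ s in (0 : ℝ)..t, impulseDeriv μ lam (t - s) * b s),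
        (∫ s in (0 : ℝ)..t, impulseDeriv₂ μ lam (t - s) * b s)) =
      oscillatorFlow μ lam t (∫ s in (0 : ℝ)..t, oscillatorFlow μ lam (-s) (b s • (1, μ))) := by
    intro t
    have hi := hc.intervalIntegrable (μ := volume) 0 t
    rw [← ContinuousLinearMap.intervalIntegral_comp_comm _ hi]
    have hE : ∀ s, oscillatorFlow μ lam t (oscillatorFlow μ lam (-s) (b s • (1, μ))) =
        (impulseDeriv μ lam (t - s) * b s, impulseDeriv₂ μ lam (t - s) * b s) := by
      intro s
      rw [← mul_apply_eq_comp, ← oscillatorFlow_add, map_smul, ← sub_eq_add_neg,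
        oscillatorFlow_apply_forcing]
      simp [mul_comm]
    simp_rw [hE]
    have c1 : Continuous fun s => impulseDeriv μ lam (t - s) * b s := by
      have := continuous_impulseDeriv μ lam
      fun_prop
    have c2 : Continuous fun s => impulseDeriv₂ μ lam (t - s) * b s := by
      have := continuous_impulseDeriv₂ μ lam
      fun_prop
    have hi' := (c1.prodMk c2).intervalIntegrable (μ := volume) 0 t
    have e1 := (ContinuousLinearMap.fst ℝ ℝ ℝ).intervalIntegral_comp_comm hi'
    have e2 := (ContinuousLinearMap.snd ℝ ℝ ℝ).intervalIntegral_comp_comm hi'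
    exact Prod.ext e1 e2
  have hd := (hasDerivAt_oscillatorFlow μ lam t).clm_apply
    (intervalIntegral.integral_hasDerivAt_right (hc.intervalIntegrable 0 t)
      hc.aestronglyMeasurable.stronglyMeasurableAtFilter hc.continuousAt)
  simp only [mul_apply_eq_comp] at hd
  rw [← hp t, oscillatorGenerator_apply, ← mul_apply_eq_comp, ← oscillatorFlow_add,
    add_neg_cancel, oscillatorFlow_zero] at hd
  rw [funext hp]
  refine hd.congr_deriv (Prod.ext ?_ ?_)
  · simp
  · simp; ring

lemma hasDerivAt_pathConv_impulse (t : ℝ) :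
    HasDerivAt (pathConv (impulse μ lam) (impulseDeriv μ lam) b)
      (pathConv (impulseDeriv μ lam) (impulseDeriv₂ μ lam) b t) t := by
  have h : HasDerivAt (fun t => ∫ s in (0 : ℝ)..t, impulseDeriv μ lam (t - s) * b s)
      ((∫ s in (0 : ℝ)..t, impulseDeriv₂ μ lam (t - s) * b s) + b t) t :=
    (hasDerivAt_conv_pair hb μ lam t).fst
  convert h using 1
  · ext t
    simp [pathConv, impulse_zero]
  · simp [pathConv, impulseDeriv_zero, add_comm]

lemma hasDerivAt_pathConv_impulseDeriv_sub (t : ℝ) :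
    HasDerivAt (fun t => pathConv (impulseDeriv μ lam) (impulseDeriv₂ μ lam) b t - b t)
      (μ * pathConv (impulseDeriv μ lam) (impulseDeriv₂ μ lam) b t
        - lam * pathConv (impulse μ lam) (impulseDeriv μ lam) b t) t := by
  have h : HasDerivAt (fun t => ∫ s in (0 : ℝ)..t, impulseDeriv₂ μ lam (t - s) * b s)
      (μ * ((∫ s in (0 : ℝ)..t, impulseDeriv₂ μ lam (t - s) * b s) + b t)
          - lam * ∫ s in (0 : ℝ)..t, impulseDeriv μ lam (t - s) * b s) t :=
    (hasDerivAt_conv_pair hb μ lam t).snd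
  convert h using 1
  · ext t
    simp [pathConv, impulseDeriv_zero]
  · simp [pathConv, impulse_zero, impulseDeriv_zero, add_comm]

lemma continuous_pathConv_impulse :
    Continuous (pathConv (impulse μ lam) (impulseDeriv μ lam) b) :=
  continuous_iff_continuousAt.2 fun t => (hasDerivAt_pathConv_impulse hb μ lam t).continuousAt

lemma continuous_pathConv_impulseDeriv :
    Continuous (pathConv (impulseDeriv μ lam) (impulseDeriv₂ μ lam) b) := by
  have : Continuous fun t => pathConv (impulseDeriv μ lam) (impulseDeriv₂ μ lam) b t - b t :=
    continuous_iff_continuousAt.2 fun t =>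
      (hasDerivAt_pathConv_impulseDeriv_sub hb μ lam t).continuousAt
  exact (this.add hb).congr fun t => by simp

lemma integral_pathConv_impulseDeriv (s t : ℝ) :
    ∫ r in s..t, pathConv (impulseDeriv μ lam) (impulseDeriv₂ μ lam) b r =
      pathConv (impulse μ lam) (impulseDeriv μ lam) b t
        - pathConv (impulse μ lam) (impulseDeriv μ lam) b s :=
  intervalIntegral.integral_eq_sub_of_hasDerivAt
    (fun r _ => hasDerivAt_pathConv_impulse hb μ lam r)
    ((continuous_pathConv_impulseDeriv hb μ lam).intervalIntegrable _ _)

lemma pathConv_impulseDeriv_sub (s t : ℝ) :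
    pathConv (impulseDeriv μ lam) (impulseDeriv₂ μ lam) b t
        - pathConv (impulseDeriv μ lam) (impulseDeriv₂ μ lam) b s =
      (∫ r in s..t, (μ * pathConv (impulseDeriv μ lam) (impulseDeriv₂ μ lam) b r
        - lam * pathConv (impulse μ lam) (impulseDeriv μ lam) b r)) + (b t - b s) := by
  have c1 := continuous_pathConv_impulseDeriv hb μ lam
  have c2 := continuous_pathConv_impulse hb μ lam
  rw [intervalIntegral.integral_eq_sub_of_hasDerivAt
    (fun r _ => hasDerivAt_pathConv_impulseDeriv_sub hb μ lam r)
    ((by fun_prop : Continuous _).intervalIntegrable _ _)]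
  ring

end Convolution

lemma pathConv_zero (g g' b : ℝ → ℝ) : pathConv g g' b 0 = g 0 * b 0 := by
  simp [pathConv]

/-- A homogeneous oscillator with zero initial data vanishes. -/
lemma oscillator_eq_zero {μ lam T : ℝ} {x v : ℝ → ℝ} (hv : Continuous v)
    (hx : ∀ t ∈ Icc 0 T, x t = ∫ s in (0 : ℝ)..t, v s)
    (hvx : ∀ t ∈ Icc 0 T, v t = ∫ s in (0 : ℝ)..t, (μ * v s - lam * x s)) :
    ∀ t ∈ Icc 0 T, x t = 0 ∧ v t = 0 := by
  -- The equations hold only on [0, T]. The primitives `y` and `z` are differentiable on the whole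
  -- line and agree there with `x` and `v`.
  set y : ℝ → ℝ := fun t => ∫ s in (0 : ℝ)..t, v s with hy
  have dy : ∀ t, HasDerivAt y (v t) t := fun t =>
    intervalIntegral.integral_hasDerivAt_right (hv.intervalIntegrable 0 t)
      hv.aestronglyMeasurable.stronglyMeasurableAtFilter hv.continuousAt
  have cy : Continuous y := continuous_iff_continuousAt.2 fun t => (dy t).continuousAt
  have cz' : Continuous fun s => μ * v s - lam * y s := by fun_prop
  set z : ℝ → ℝ := fun t => ∫ s in (0 : ℝ)..t, (μ * v s - lam * y s) with hz
  have dz : ∀ t, HasDerivAt z (μ * v t - lam * y t) t := fun t =>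
    intervalIntegral.integral_hasDerivAt_right (cz'.intervalIntegrable 0 t)
      cz'.aestronglyMeasurable.stronglyMeasurableAtFilter cz'.continuousAt
  have cz : Continuous z := continuous_iff_continuousAt.2 fun t => (dz t).continuousAt
  have hvz : ∀ t ∈ Icc 0 T, v t = z t := by
    intro t ht
    rw [hvx t ht]
    refine intervalIntegral.integral_congr fun s hs => ?_
    rw [uIcc_of_le ht.1] at hs
    rw [hx s ⟨hs.1, hs.2.trans ht.2⟩]
  have key : EqOn (fun t => (y t, z t)) (fun _ => (0, 0)) (Icc 0 T) := by
    refine ODE_solution_unique (v := fun _ p => oscillatorGenerator μ lam p)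
      (K := ‖oscillatorGenerator μ lam‖₊) (fun _ => (oscillatorGenerator μ lam).lipschitz)
      (cy.prodMk cz).continuousOn (fun t ht => ?_) continuousOn_const (fun t _ => ?_) ?_
    · rw [oscillatorGenerator_apply, ← hvz t ⟨ht.1, ht.2.le⟩]
      exact ((dy t).prodMk (dz t)).hasDerivWithinAt
    · rw [oscillatorGenerator_apply]
      simpa [← Prod.zero_eq_mk] using hasDerivWithinAt_const t (Ici t) (0 : ℝ × ℝ)
    · simp [hy, hz]
  intro t ht
  have := key ht
  simp only [Prod.mk.injEq] at this
  exact ⟨(hx t ht).trans this.1, (hvz t ht).trans this.2⟩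

/-! ### Energy estimates and bounds uniform in the mode -/

/-- Energy estimate for the impulse response. -/
lemma impulse_energy_le {μ lam C t : ℝ} (hlam : 0 ≤ lam) (hμ : μ ≤ C) (hC : 0 ≤ C) (ht : 0 ≤ t) :
    impulseDeriv μ lam t ^ 2 + lam * impulse μ lam t ^ 2 ≤ Real.exp (2 * C * t) := by
  set E : ℝ → ℝ := fun t =>
    (impulseDeriv μ lam t ^ 2 + lam * impulse μ lam t ^ 2) * Real.exp (-(2 * C * t)) with hE
  have hd : ∀ t, HasDerivAt E ((2 * impulseDeriv μ lam t * impulseDeriv₂ μ lam t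
      + lam * (2 * impulse μ lam t * impulseDeriv μ lam t)) * Real.exp (-(2 * C * t))
      + (impulseDeriv μ lam t ^ 2 + lam * impulse μ lam t ^ 2)
        * (Real.exp (-(2 * C * t)) * (-(2 * C)))) t := by
    intro t
    have h0 : HasDerivAt (fun t : ℝ => -(2 * C * t)) (-(2 * C)) t := by
      simpa using ((hasDerivAt_id' t).const_mul (2 * C)).fun_neg
    have h1 := (hasDerivAt_impulseDeriv μ lam t).pow 2
    have h2 := ((hasDerivAt_impulse μ lam t).pow 2).const_mul lam
    refine ((h1.add h2).mul h0.exp).congr_deriv ?_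
    simp
  -- The derivative of E is 2 ((μ - C) f'² - C λ f²) exp(-2Ct), and both terms are nonpositive.
  have hanti : Antitone E := by
    refine antitone_of_deriv_nonpos (fun t => (hd t).differentiableAt) fun t => ?_
    rw [(hd t).deriv]
    have h1 : (μ - C) * impulseDeriv μ lam t ^ 2 ≤ 0 :=
      mul_nonpos_of_nonpos_of_nonneg (by linarith) (sq_nonneg _)
    have h2 : 0 ≤ C * (lam * impulse μ lam t ^ 2) := by positivity
    have h3 := (Real.exp_pos (-(2 * C * t))).le
    have : (2 * impulseDeriv μ lam t * impulseDeriv₂ μ lam t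
      + lam * (2 * impulse μ lam t * impulseDeriv μ lam t)) * Real.exp (-(2 * C * t))
      + (impulseDeriv μ lam t ^ 2 + lam * impulse μ lam t ^ 2)
        * (Real.exp (-(2 * C * t)) * (-(2 * C))) =
      2 * ((μ - C) * impulseDeriv μ lam t ^ 2 - C * (lam * impulse μ lam t ^ 2))
        * Real.exp (-(2 * C * t)) := by
      rw [impulseDeriv₂]; ring
    rw [this]
    exact mul_nonpos_of_nonpos_of_nonneg (by linarith) h3
  have h := hanti ht
  simp only [hE, impulse_zero, impulseDeriv_zero] at h
  rw [Real.exp_neg, ← div_eq_mul_inv, div_le_iff₀ (Real.exp_pos _)] at h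
  simpa using h

/-- Energy identity for the impulse response after removing the damping term. -/
lemma underdamped_impulse_sq_le (μ lam t : ℝ) :
    (lam - μ ^ 2 / 4) * impulse μ lam t ^ 2 ≤ Real.exp (μ * t) := by
  -- This is the energy of g = exp(-μt/2) f, which solves g'' + (λ - μ²/4) g = 0. It is conserved
  -- with value 1, whatever the sign of λ - μ²/4.
  set E : ℝ → ℝ := fun t => ((impulseDeriv μ lam t - μ / 2 * impulse μ lam t) ^ 2
      + (lam - μ ^ 2 / 4) * impulse μ lam t ^ 2) * Real.exp (-(μ * t)) with hE
  have hd : ∀ t, HasDerivAt E 0 t := by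
    intro t
    have h0 : HasDerivAt (fun t : ℝ => -(μ * t)) (-μ) t := by
      simpa using ((hasDerivAt_id' t).const_mul μ).fun_neg
    have h1 := ((hasDerivAt_impulseDeriv μ lam t).sub
      ((hasDerivAt_impulse μ lam t).const_mul (μ / 2))).pow 2
    have h2 := ((hasDerivAt_impulse μ lam t).pow 2).const_mul (lam - μ ^ 2 / 4)
    refine ((h1.add h2).mul h0.exp).congr_deriv ?_
    simp only [Pi.add_apply, Pi.sub_apply, Pi.pow_apply, impulseDeriv₂, Nat.cast_ofNat]
    ring
  have h : E t = E 0 := is_const_of_deriv_eq_zero (fun t => (hd t).differentiableAt)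
    (fun t => (hd t).deriv) t 0
  simp only [hE, impulse_zero, impulseDeriv_zero] at h
  rw [Real.exp_neg, ← div_eq_mul_inv, div_eq_iff (Real.exp_pos _).ne'] at h
  have : (impulseDeriv μ lam t - μ / 2 * impulse μ lam t) ^ 2 +
    (lam - μ ^ 2 / 4) * impulse μ lam t ^ 2 = Real.exp (μ * t) := by simpa using h
  nlinarith [sq_nonneg (impulseDeriv μ lam t - μ / 2 * impulse μ lam t)]

/-- An eventual uniform bound on `[0, T]` for continuous functions is a uniform bound. -/
lemma exists_uniform_bound {g : ℕ → ℝ → ℝ} {T M : ℝ} (hg : ∀ k, Continuous (g k))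
    (h : ∀ᶠ k in atTop, ∀ t ∈ Icc 0 T, g k t ≤ M) : ∃ M', ∀ k, ∀ t ∈ Icc 0 T, g k t ≤ M' := by
  obtain ⟨K, hK⟩ := eventually_atTop.1 h
  have hb : ∀ k, ∃ m, ∀ t ∈ Icc 0 T, g k t ≤ m := fun k => by
    obtain ⟨m, hm⟩ := (isCompact_Icc (a := (0 : ℝ)) (b := T)).bddAbove_image (hg k).continuousOn
    exact ⟨m, fun t ht => hm ⟨t, ht, rfl⟩⟩
  choose m hm using hb
  obtain ⟨m', hm'⟩ := ((Finset.range K).image m).bddAbove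
  refine ⟨max M m', fun k t ht => ?_⟩
  by_cases hk : k < K
  · refine (hm k t ht).trans (le_max_of_le_right (hm' ?_))
    exact Finset.mem_coe.2 (Finset.mem_image_of_mem m (Finset.mem_range.2 hk))
  · exact le_max_of_le_left (hK k (not_lt.1 hk) t ht)

lemma exists_impulse_sq_bound {μ lam : ℕ → ℝ} {T C : ℝ} (hT : 0 < T)
    (hlam : Tendsto lam atTop atTop)
    (hμ : ∀ᶠ k in atTop, T * μ k ≤ Real.log (lam k) + C) :
    ∃ M, ∀ k, ∀ t ∈ Icc 0 T, impulse (μ k) (lam k) t ^ 2 ≤ M := by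
  -- The factor T²/2 is chosen so that Tμ ≤ 2 log λ gives T²μ² ≤ 4 log² λ ≤ 2 T² λ, hence λ - μ²/4 ≥
  -- λ/2.
  have hlog : ∀ᶠ x : ℝ in atTop, Real.log x ^ 2 ≤ T ^ 2 / 2 * x := by
    have h := (Real.isLittleO_pow_log_id_atTop (n := 2)).bound
      (show (0 : ℝ) < T ^ 2 / 2 by positivity)
    filter_upwards [h, eventually_ge_atTop 0] with x hx h0
    simpa [abs_of_nonneg h0] using hx
  -- The bound 1 serves the modes with μ ≤ 0, and 2 exp C those with μ > 0. The finitely many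
  -- remaining modes are bounded by compactness of [0, T].
  refine exists_uniform_bound (M := max 1 (2 * Real.exp C))
    (fun k => (continuous_impulse _ _).pow 2) ?_
  filter_upwards [hμ, hlam.eventually hlog, hlam.eventually (eventually_ge_atTop 1),
    hlam.eventually (Real.tendsto_log_atTop.eventually (eventually_ge_atTop C))]
    with k h1 h2 h3 h4 t ht
  rcases le_or_gt (μ k) 0 with hneg | hpos
  · have h := impulse_energy_le (zero_le_one.trans h3) hneg le_rfl ht.1
    refine le_max_of_le_left ?_
    simp only [mul_zero, zero_mul, Real.exp_zero] at h
    nlinarith [sq_nonneg (impulseDeriv (μ k) (lam k) t), sq_nonneg (impulse (μ k) (lam k) t)]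
  · have h := underdamped_impulse_sq_le (μ k) (lam k) t
    refine le_max_of_le_right ?_
    have h5 : T * μ k ≤ 2 * Real.log (lam k) := by linarith
    have h6 : (T * μ k) ^ 2 ≤ 4 * Real.log (lam k) ^ 2 := by
      have := pow_le_pow_left₀ (by positivity) h5 2
      linarith
    have h7 : μ k ^ 2 ≤ 2 * lam k := by
      have : T ^ 2 * μ k ^ 2 ≤ T ^ 2 * (2 * lam k) := by nlinarith
      exact le_of_mul_le_mul_left this (by positivity)
    have h8 : Real.exp (μ k * t) ≤ lam k * Real.exp C := by
      have : Real.exp (μ k * t) ≤ Real.exp (Real.log (lam k) + C) := by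
        refine Real.exp_le_exp.2 (le_trans ?_ h1)
        rw [mul_comm]
        exact mul_le_mul_of_nonneg_right ht.2 hpos.le
      rwa [Real.exp_add, Real.exp_log (by linarith)] at this
    have h9 : lam k * impulse (μ k) (lam k) t ^ 2 ≤ lam k * (2 * Real.exp C) := by
      nlinarith [sq_nonneg (impulse (μ k) (lam k) t)]
    exact le_of_mul_le_mul_left h9 (by linarith)

lemma exists_impulseDeriv_sq_bound {μ lam : ℕ → ℝ} {T C : ℝ}
    (hlam : Tendsto lam atTop atTop) (hμ : ∀ k, μ k ≤ C) :
    ∃ M, ∀ k, ∀ t ∈ Icc 0 T, impulseDeriv (μ k) (lam k) t ^ 2 ≤ M := by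
  -- The energy estimate needs a nonnegative rate, hence max C 0.
  refine exists_uniform_bound (M := Real.exp (2 * max C 0 * T))
    (fun k => (continuous_impulseDeriv _ _).pow 2) ?_
  filter_upwards [hlam.eventually (eventually_ge_atTop 0)] with k hk t ht
  have h := impulse_energy_le hk ((hμ k).trans (le_max_left C 0)) (le_max_right C 0) ht.1
  have h' : Real.exp (2 * max C 0 * t) ≤ Real.exp (2 * max C 0 * T) :=
    Real.exp_le_exp.2 (mul_le_mul_of_nonneg_left ht.2 (by positivity))
  nlinarith [mul_nonneg hk (sq_nonneg (impulse (μ k) (lam k) t))]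

lemma IsHyperbolic.tendsto_atTop {Θ₁ Θ₂ : Set ℝ} {T : ℝ} {κ τ ρ ν : ℕ → ℝ}
    (h : IsHyperbolic Θ₁ Θ₂ T κ τ ρ ν) {θ : ℝ} (hθ : θ ∈ Θ₁) :
    Tendsto (fun k => κ k + θ * τ k) atTop atTop := by
  obtain ⟨Cs, -, -, -, -, -, h1, -⟩ := h.evolution
  obtain ⟨-, hm, hb⟩ := h1 θ hθ
  have := tendsto_atTop_atTop_of_monotone' hm hb
  simpa using tendsto_atTop_add_const_right _ (-Cs) this

/-! ### Second moments and Minkowski's integral inequality -/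

lemma le_rpow_of_sq_le {a c : ℝ≥0∞} (h : a ^ 2 ≤ c) : a ≤ c ^ (2⁻¹ : ℝ) := by
  rw [ENNReal.le_rpow_inv_iff two_pos]
  simpa using h

lemma eLpNorm_two_sq {α E : Type*} {m : MeasurableSpace α} [NormedAddCommGroup E] (μ : Measure α)
    (f : α → E) : eLpNorm f 2 μ ^ 2 = ∫⁻ x, ‖f x‖ₑ ^ 2 ∂μ := by
  have h := eLpNorm_nnreal_pow_eq_lintegral (μ := μ) (f := f) (p := 2) two_ne_zero
  simpa using h

lemma eLpNorm_two_sq_eq_ofReal {α E : Type*} {m : MeasurableSpace α} [NormedAddCommGroup E]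
    {μ : Measure α} {f : α → E} (hf : MemLp f 2 μ) :
    eLpNorm f 2 μ ^ 2 = ENNReal.ofReal (∫ x, ‖f x‖ ^ 2 ∂μ) := by
  rw [eLpNorm_two_sq, ofReal_integral_eq_lintegral_ofReal
    ((memLp_two_iff_integrable_sq_norm hf.1).1 hf) (ae_of_all _ fun _ => by positivity)]
  refine lintegral_congr fun x => ?_
  rw [ENNReal.ofReal_pow (norm_nonneg _), ofReal_norm]

lemma integrable_mul_of_memLp_two {α : Type*} {m : MeasurableSpace α} {μ : Measure α}
    {f g : α → ℝ} (hf : MemLp f 2 μ) (hg : MemLp g 2 μ) : Integrable (fun x => f x * g x) μ :=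
  hf.integrable_mul hg

/-- Minkowski's integral inequality in `L²`, for a uniformly bounded integrand. -/
lemma eLpNorm_two_integral_le {Ω S : Type*} {mΩ : MeasurableSpace Ω} {mS : MeasurableSpace S}
    {P : Measure Ω} [SFinite P] {m : Measure S} [IsFiniteMeasure m] {ξ : S → Ω → ℝ}
    (hξ : StronglyMeasurable (Function.uncurry ξ)) {c : ℝ≥0∞}
    (h : ∀ᵐ r ∂m, eLpNorm (ξ r) 2 P ≤ c) :
    eLpNorm (fun ω => ∫ r, ξ r ω ∂m) 2 P ≤ m univ * c := by
  -- Cauchy–Schwarz in r for each fixed ω; Tonelli then exchanges the two integrals.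
  have hpt : ∀ ω, ‖∫ r, ξ r ω ∂m‖ₑ ^ 2 ≤ (∫⁻ r, ‖ξ r ω‖ₑ ^ 2 ∂m) * m univ := by
    intro ω
    have hm : AEStronglyMeasurable (fun r => ξ r ω) m :=
      (hξ.comp_measurable measurable_prodMk_right).aestronglyMeasurable
    have h1 : ‖∫ r, ξ r ω ∂m‖ₑ ≤ eLpNorm (fun r => ξ r ω) 1 m := by
      rw [eLpNorm_one_eq_lintegral_enorm]
      exact enorm_integral_le_lintegral_enorm _
    have h2 := h1.trans (eLpNorm_le_eLpNorm_mul_rpow_measure_univ one_le_two hm)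
    have h3 := pow_le_pow_left₀ zero_le h2 2
    rw [mul_pow, eLpNorm_two_sq, ← ENNReal.rpow_mul_natCast] at h3
    norm_num at h3
    exact h3
  have hsq : eLpNorm (fun ω => ∫ r, ξ r ω ∂m) 2 P ^ 2 ≤ (m univ * c) ^ 2 := by
    rw [eLpNorm_two_sq]
    calc ∫⁻ ω, ‖∫ r, ξ r ω ∂m‖ₑ ^ 2 ∂P ≤ ∫⁻ ω, (∫⁻ r, ‖ξ r ω‖ₑ ^ 2 ∂m) * m univ ∂P :=
          lintegral_mono hpt
      _ = (∫⁻ r, ∫⁻ ω, ‖ξ r ω‖ₑ ^ 2 ∂P ∂m) * m univ := by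
          rw [lintegral_mul_const' _ _ (measure_ne_top m univ), lintegral_lintegral_swap]
          exact ((hξ.comp_measurable measurable_swap).enorm.pow_const 2).aemeasurable
      _ ≤ (∫⁻ _, c ^ 2 ∂m) * m univ := by
          gcongr ?_ * _
          refine lintegral_mono_ae ?_
          filter_upwards [h] with r hr
          rw [← eLpNorm_two_sq]
          gcongr
      _ = (m univ * c) ^ 2 := by rw [lintegral_const]; ring
  exact (ENNReal.pow_le_pow_left_iff two_ne_zero).1 hsq

lemma eLpNorm_two_intervalIntegral_le {Ω : Type*} {mΩ : MeasurableSpace Ω}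
    {P : Measure Ω} [SFinite P] {ξ : ℝ → Ω → ℝ} (hξ : StronglyMeasurable (Function.uncurry ξ))
    {c : ℝ≥0∞} {s t : ℝ} (h : ∀ r ∈ uIcc s t, eLpNorm (ξ r) 2 P ≤ c) :
    eLpNorm (fun ω => ∫ r in s..t, ξ r ω) 2 P ≤ ENNReal.ofReal |t - s| * c := by
  have h1 : eLpNorm (fun ω => ∫ r in s..t, ξ r ω) 2 P =
      eLpNorm (fun ω => ∫ r in uIoc s t, ξ r ω) 2 P :=
    eLpNorm_congr_norm_ae (ae_of_all _ fun ω => intervalIntegral.norm_intervalIntegral_eq _ _ _ _)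
  have : IsFiniteMeasure (volume.restrict (uIoc s t)) := ⟨by simp⟩
  rw [h1]
  refine (eLpNorm_two_integral_le (m := volume.restrict (uIoc s t)) hξ (c := c) ?_).trans_eq ?_
  · exact (ae_restrict_mem measurableSet_uIoc).mono fun r hr => h r (uIoc_subset_uIcc hr)
  · rw [Measure.restrict_apply_univ, Real.volume_uIoc]

/-! ### Closed linear span of the noise and orthogonality -/

/-- A square-integrable process on `[0, ∞)` with continuous paths and the covariance of Brownian
motion. -/
structure IsBrownianCov {Ω : Type*} {mΩ : MeasurableSpace Ω} (P : Measure Ω) (b : ℝ → Ω → ℝ) :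
    Prop where
  cont : ∀ ω, Continuous fun s => b s ω
  meas : ∀ s, Measurable (b s)
  memLp : ∀ s, MemLp (b s) 2 P
  cov : ∀ s r, 0 ≤ s → 0 ≤ r → ∫ ω, b s ω * b r ω ∂P = min s r

/-- `Y` annihilates the orthogonal complement of the process `b` in `L²`. -/
def IsLinearFunctional {Ω : Type*} {mΩ : MeasurableSpace Ω} (P : Measure Ω) (b : ℝ → Ω → ℝ)
    (Y : Ω → ℝ) : Prop :=
  MemLp Y 2 P ∧ ∀ V, MemLp V 2 P → (∀ s, 0 ≤ s → ∫ ω, b s ω * V ω ∂P = 0) →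
    ∫ ω, Y ω * V ω ∂P = 0

section LinearFunctional

variable {Ω : Type*} {mΩ : MeasurableSpace Ω} {P : Measure Ω} {b b' : ℝ → Ω → ℝ} {Y Y' : Ω → ℝ}

lemma IsLinearFunctional.sub (h : IsLinearFunctional P b Y) (h' : IsLinearFunctional P b Y') :
    IsLinearFunctional P b (fun ω => Y ω - Y' ω) := by
  refine ⟨h.1.sub h'.1, fun V hV hs => ?_⟩
  simp_rw [sub_mul]
  rw [integral_sub (integrable_mul_of_memLp_two h.1 hV)
    (integrable_mul_of_memLp_two h'.1 hV), h.2 V hV hs, h'.2 V hV hs,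
    sub_zero]

lemma IsLinearFunctional.const_mul (h : IsLinearFunctional P b Y) (c : ℝ) :
    IsLinearFunctional P b (fun ω => c * Y ω) := by
  refine ⟨h.1.const_mul c, fun V hV hs => ?_⟩
  simp_rw [mul_assoc]
  rw [integral_const_mul, h.2 V hV hs, mul_zero]

lemma IsLinearFunctional.congr (h : IsLinearFunctional P b Y) (hY : Y =ᵐ[P] Y') :
    IsLinearFunctional P b Y' := by
  refine ⟨h.1.ae_eq hY, fun V hV hs => ?_⟩
  rw [← h.2 V hV hs]
  exact integral_congr_ae (hY.symm.mul (ae_eq_refl V))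

/-- Orthogonality of generators passes to closed spans by using the annihilator property twice: each
`b s` is a test variable for `Y'`, and this makes `Y'` a test variable for `Y`. -/
lemma IsLinearFunctional.integral_mul_eq_zero (hb : ∀ s, MemLp (b s) 2 P)
    (h : IsLinearFunctional P b Y) (h' : IsLinearFunctional P b' Y')
    (hbb : ∀ s r, 0 ≤ s → 0 ≤ r → ∫ ω, b s ω * b' r ω ∂P = 0) :
    ∫ ω, Y ω * Y' ω ∂P = 0 := by
  refine h.2 Y' h'.1 fun s hs => ?_
  simp_rw [mul_comm (b s _)]
  refine h'.2 (b s) (hb s) fun r hr => ?_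
  simp_rw [mul_comm (b' r _)]
  exact hbb s r hs hr

end LinearFunctional

/-! ### Pathwise Wiener integrals and their isometry -/

section WienerIntegral

variable {Ω : Type*} {mΩ : MeasurableSpace Ω} {P : Measure Ω} {b : ℝ → Ω → ℝ}

lemma IsBrownianCov.stronglyMeasurable_uncurry (hb : IsBrownianCov P b) :
    StronglyMeasurable (Function.uncurry b) :=
  stronglyMeasurable_uncurry_of_continuous_of_stronglyMeasurable hb.cont
    fun s => (hb.meas s).stronglyMeasurable

lemma IsBrownianCov.stronglyMeasurable_uncurry_mul (hb : IsBrownianCov P b) {g : ℝ → ℝ}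
    (hg : Continuous g) : StronglyMeasurable (Function.uncurry fun s ω => g s * b s ω) :=
  (hg.stronglyMeasurable.comp_measurable measurable_fst).mul hb.stronglyMeasurable_uncurry

lemma IsBrownianCov.eLpNorm_sq (hb : IsBrownianCov P b) {s : ℝ} (hs : 0 ≤ s) :
    eLpNorm (b s) 2 P ^ 2 = ENNReal.ofReal s := by
  rw [eLpNorm_two_sq_eq_ofReal (hb.memLp s)]
  simp_rw [Real.norm_eq_abs, sq_abs, pow_two]
  rw [hb.cov s s hs hs, min_self]

lemma IsBrownianCov.eLpNorm_sub_sq (hb : IsBrownianCov P b) {s t : ℝ} (hs : 0 ≤ s) (ht : 0 ≤ t) :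
    eLpNorm (fun ω => b t ω - b s ω) 2 P ^ 2 = ENNReal.ofReal |t - s| := by
  have h := eLpNorm_two_sq_eq_ofReal ((hb.memLp t).sub (hb.memLp s))
  simp only [Pi.sub_apply] at h
  refine h.trans ?_
  congr 1
  have e : ∀ ω, ‖b t ω - b s ω‖ ^ 2 =
      b t ω * b t ω - 2 * (b t ω * b s ω) + b s ω * b s ω := fun ω => by
    rw [Real.norm_eq_abs, sq_abs]; ring
  have i1 := integrable_mul_of_memLp_two (hb.memLp t) (hb.memLp t)
  have i2 := integrable_mul_of_memLp_two (hb.memLp t) (hb.memLp s)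
  have i3 := integrable_mul_of_memLp_two (hb.memLp s) (hb.memLp s)
  simp_rw [e]
  rw [integral_add (f := fun x => b t x * b t x - 2 * (b t x * b s x)) (i1.sub (i2.const_mul 2)) i3, integral_sub i1 (i2.const_mul 2),
    integral_const_mul, hb.cov _ _ ht ht, hb.cov _ _ ht hs, hb.cov _ _ hs hs, min_self, min_self]
  rcases le_total s t with h | h
  · rw [min_eq_right h, abs_of_nonneg (by linarith)]; ring
  · rw [min_eq_left h, abs_of_nonpos (by linarith)]; ring

lemma IsBrownianCov.exists_eLpNorm_mul_le (hb : IsBrownianCov P b) {g : ℝ → ℝ}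
    (hg : Continuous g) {t : ℝ} (ht : 0 ≤ t) :
    ∃ c : ℝ≥0∞, c ≠ ∞ ∧ ∀ s ∈ uIcc 0 t, eLpNorm (fun ω => g s * b s ω) 2 P ≤ c := by
  obtain ⟨G, hG⟩ := (isCompact_uIcc (a := (0 : ℝ)) (b := t)).exists_bound_of_continuousOn
    hg.continuousOn
  refine ⟨ENNReal.ofReal G * ENNReal.ofReal (√t),
    ENNReal.mul_ne_top ENNReal.ofReal_ne_top ENNReal.ofReal_ne_top, fun s hs => ?_⟩
  have h1 : eLpNorm (fun ω => g s * b s ω) 2 P = ‖g s‖ₑ * eLpNorm (b s) 2 P :=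
    eLpNorm_const_smul (g s) (b s) 2 P
  rw [h1]
  gcongr
  · rw [← ofReal_norm]
    exact ENNReal.ofReal_le_ofReal (hG s hs)
  · rw [uIcc_of_le ht] at hs
    rw [← ENNReal.pow_le_pow_left_iff two_ne_zero, hb.eLpNorm_sq hs.1,
      ← ENNReal.ofReal_pow (Real.sqrt_nonneg _), Real.sq_sqrt ht]
    exact ENNReal.ofReal_le_ofReal hs.2

variable [IsProbabilityMeasure P]

lemma IsBrownianCov.memLp_integral (hb : IsBrownianCov P b) {g : ℝ → ℝ}
    (hg : Continuous g) {t : ℝ} (ht : 0 ≤ t) :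
    MemLp (fun ω => ∫ s in (0 : ℝ)..t, g s * b s ω) 2 P := by
  obtain ⟨c, hc, hgc⟩ := hb.exists_eLpNorm_mul_le hg ht
  have hm := hb.stronglyMeasurable_uncurry_mul hg
  refine ⟨?_, (eLpNorm_two_intervalIntegral_le hm hgc).trans_lt
    (ENNReal.mul_lt_top ENNReal.ofReal_lt_top hc.lt_top)⟩
  simp_rw [intervalIntegral.integral_of_le ht]
  exact (StronglyMeasurable.integral_prod_right' (f := fun p : Ω × ℝ => g p.2 * b p.2 p.1)
    (hm.comp_measurable measurable_swap)).aestronglyMeasurable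

/-- Fubini, justified by Hölder and a bound on the L² norm of g(s) b(s) uniform over [0, t]. It
reduces moments of the convolution to covariances of the noise. -/
lemma IsBrownianCov.integral_integral_mul (hb : IsBrownianCov P b) {g : ℝ → ℝ}
    (hg : Continuous g) {t : ℝ} (ht : 0 ≤ t) {Y : Ω → ℝ} (hY : MemLp Y 2 P) :
    ∫ ω, (∫ s in (0 : ℝ)..t, g s * b s ω) * Y ω ∂P =
      ∫ s in (0 : ℝ)..t, g s * ∫ ω, b s ω * Y ω ∂P := by
  obtain ⟨c, hc, hgc⟩ := hb.exists_eLpNorm_mul_le hg ht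
  have hm := hb.stronglyMeasurable_uncurry_mul hg
  have hmY : AEStronglyMeasurable (fun p : Ω × ℝ => g p.2 * b p.2 p.1 * Y p.1)
      (P.prod (volume.restrict (Ioc 0 t))) :=
    (hm.comp_measurable measurable_swap).aestronglyMeasurable.mul hY.1.comp_fst
  have hint : Integrable (fun p : Ω × ℝ => g p.2 * b p.2 p.1 * Y p.1)
      (P.prod (volume.restrict (Ioc 0 t))) := by
    refine ⟨hmY, ?_⟩
    rw [HasFiniteIntegral, lintegral_prod_symm _ hmY.enorm]
    calc ∫⁻ s in Ioc 0 t, ∫⁻ ω, ‖g s * b s ω * Y ω‖ₑ ∂P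
        ≤ ∫⁻ _ in Ioc 0 t, c * eLpNorm Y 2 P := by
          refine setLIntegral_mono measurable_const fun s hs => ?_
          have h1 := eLpNorm_smul_le_mul_eLpNorm (p := 2) (q := 2) (r := 1) (μ := P) hY.1
            (((hb.memLp s).const_mul (g s)).1)
          rw [eLpNorm_one_eq_lintegral_enorm] at h1
          refine h1.trans ?_
          gcongr
          exact hgc s (by rw [uIcc_of_le ht]; exact ⟨hs.1.le, hs.2⟩)
      _ < ∞ := by
          rw [setLIntegral_const]
          exact ENNReal.mul_lt_top (ENNReal.mul_lt_top hc.lt_top hY.2) (by simp)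
  simp_rw [intervalIntegral.integral_of_le ht, ← integral_mul_const]
  rw [integral_integral_swap hint]
  refine integral_congr_ae (ae_of_all _ fun s => ?_)
  simp only [mul_assoc]
  rw [integral_const_mul]

lemma IsBrownianCov.isLinearFunctional_pathConv (hb : IsBrownianCov P b) {g g' : ℝ → ℝ}
    (hg' : Continuous g') {t : ℝ} (ht : 0 ≤ t) :
    IsLinearFunctional P b (fun ω => pathConv g g' (fun s => b s ω) t) := by
  have hc : Continuous fun s => g' (t - s) := by fun_prop
  have hK := hb.memLp_integral hc ht
  refine ⟨((hb.memLp t).const_mul (g 0)).add hK, fun V hV hs => ?_⟩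
  simp only [pathConv, add_mul]
  rw [integral_add (integrable_mul_of_memLp_two ((hb.memLp t).const_mul (g 0)) hV) (integrable_mul_of_memLp_two hK hV),
    hb.integral_integral_mul hc ht hV]
  simp_rw [mul_assoc]
  rw [integral_const_mul, hs t ht, mul_zero, zero_add]
  refine (intervalIntegral.integral_congr fun s hs' => ?_).trans intervalIntegral.integral_zero
  rw [uIcc_of_le ht] at hs'
  simp [hs s hs'.1]

/-- Splitting at r makes min(s, r) equal to s and then to r; integration by parts on [0, r] does the
rest. The left side is the covariance of b(r) with the convolution at time t, by
`IsBrownianCov.integral_mul_pathConv`. -/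
lemma integral_mul_min_eq {g g' : ℝ → ℝ} (hg : ∀ t, HasDerivAt g (g' t) t) (hg' : Continuous g')
    {r t : ℝ} (hr : r ∈ Icc 0 t) :
    g 0 * r + ∫ s in (0 : ℝ)..t, g' (t - s) * min s r = ∫ s in (0 : ℝ)..r, g (t - s) := by
  have cg : Continuous g := continuous_iff_continuousAt.2 fun t => (hg t).continuousAt
  have hd : ∀ s, HasDerivAt (fun s => -g (t - s)) (g' (t - s)) s := fun s => by
    simpa using ((hg (t - s)).comp_const_sub t s).fun_neg
  have c1 : Continuous fun s => g' (t - s) := by fun_prop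
  have c2 : Continuous fun s => g' (t - s) * min s r := by fun_prop
  rw [← intervalIntegral.integral_add_adjacent_intervals (c2.intervalIntegrable 0 r)
    (c2.intervalIntegrable r t)]
  have e1 : ∫ s in (0 : ℝ)..r, g' (t - s) * min s r = ∫ s in (0 : ℝ)..r, s * g' (t - s) := by
    refine intervalIntegral.integral_congr fun s hs => ?_
    rw [uIcc_of_le hr.1] at hs
    simp only [min_eq_left hs.2, mul_comm]
  have e2 : ∫ s in r..t, g' (t - s) * min s r = (∫ s in r..t, g' (t - s)) * r := by
    rw [← intervalIntegral.integral_mul_const]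
    refine intervalIntegral.integral_congr fun s hs => ?_
    rw [uIcc_of_le hr.2] at hs
    simp only [min_eq_right hs.1]
  have e3 := intervalIntegral.integral_mul_deriv_eq_deriv_mul (a := 0) (b := r)
    (fun s _ => hasDerivAt_id s) (fun s _ => hd s) (intervalIntegrable_const)
    (c1.intervalIntegrable _ _)
  have e4 := intervalIntegral.integral_eq_sub_of_hasDerivAt (a := r) (b := t) (fun s _ => hd s)
    (c1.intervalIntegrable _ _)
  simp only [id_eq, one_mul, intervalIntegral.integral_neg] at e3
  rw [e1, e2, e3, e4]
  simp
  ring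

lemma IsBrownianCov.integral_mul_pathConv (hb : IsBrownianCov P b) {g g' : ℝ → ℝ}
    (hg : ∀ t, HasDerivAt g (g' t) t) (hg' : Continuous g') {r t : ℝ} (hr : r ∈ Icc 0 t) :
    ∫ ω, b r ω * pathConv g g' (fun s => b s ω) t ∂P = ∫ s in (0 : ℝ)..r, g (t - s) := by
  have ht := hr.1.trans hr.2
  have hc : Continuous fun s => g' (t - s) := by fun_prop
  have hK := hb.memLp_integral hc ht
  simp only [mul_comm (b r _), pathConv, add_mul]
  rw [integral_add (integrable_mul_of_memLp_two ((hb.memLp t).const_mul (g 0)) (hb.memLp r))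
    (integrable_mul_of_memLp_two hK (hb.memLp r)), hb.integral_integral_mul hc ht (hb.memLp r)]
  simp_rw [mul_assoc]
  rw [integral_const_mul, hb.cov t r ht hr.1, min_eq_right hr.2,
    ← integral_mul_min_eq hg hg' hr]
  congr 1
  refine intervalIntegral.integral_congr fun s hs => ?_
  rw [uIcc_of_le ht] at hs
  rw [hb.cov s r hs.1 hr.1]

/-- Itô isometry for the pathwise Wiener integral. -/
lemma IsBrownianCov.integral_pathConv_sq (hb : IsBrownianCov P b) {g g' : ℝ → ℝ}
    (hg : ∀ t, HasDerivAt g (g' t) t) (hg' : Continuous g') {t : ℝ} (ht : 0 ≤ t) :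
    ∫ ω, pathConv g g' (fun s => b s ω) t ^ 2 ∂P = ∫ s in (0 : ℝ)..t, g (t - s) ^ 2 := by
  have cg : Continuous g := continuous_iff_continuousAt.2 fun t => (hg t).continuousAt
  have hc : Continuous fun s => g' (t - s) := by fun_prop
  have hgt : Continuous fun s => g (t - s) := by fun_prop
  have hK := hb.memLp_integral hc ht
  set Z : Ω → ℝ := fun ω => pathConv g g' (fun s => b s ω) t with hZ
  have hZm : MemLp Z 2 P := (hb.isLinearFunctional_pathConv hg' ht).1
  -- Only one of the two factors is expanded, so that the known covariance of b(s) with the whole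
  -- convolution applies.
  have e0 : ∀ ω, pathConv g g' (fun s => b s ω) t ^ 2 =
      g 0 * (b t ω * Z ω) + (∫ s in (0 : ℝ)..t, g' (t - s) * b s ω) * Z ω := by
    intro ω
    simp only [hZ, pathConv]
    ring
  simp_rw [e0]
  rw [integral_add ((integrable_mul_of_memLp_two (hb.memLp t) hZm).const_mul (g 0)) (integrable_mul_of_memLp_two hK hZm),
    integral_const_mul, hb.integral_integral_mul hc ht hZm]
  have e1 : ∫ s in (0 : ℝ)..t, g' (t - s) * ∫ ω, b s ω * Z ω ∂P =
      ∫ s in (0 : ℝ)..t, (∫ r in (0 : ℝ)..s, g (t - r)) * g' (t - s) := by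
    refine intervalIntegral.integral_congr fun s hs => ?_
    rw [uIcc_of_le ht] at hs
    simp only [hZ]
    rw [hb.integral_mul_pathConv hg hg' hs, mul_comm]
  have hd : ∀ s, HasDerivAt (fun s => -g (t - s)) (g' (t - s)) s := fun s => by
    simpa using ((hg (t - s)).comp_const_sub t s).fun_neg
  have hG : ∀ s, HasDerivAt (fun s => ∫ r in (0 : ℝ)..s, g (t - r)) (g (t - s)) s := fun s =>
    intervalIntegral.integral_hasDerivAt_right (hgt.intervalIntegrable 0 s)
      hgt.aestronglyMeasurable.stronglyMeasurableAtFilter hgt.continuousAt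
  -- The boundary term -g(0) ∫₀ᵗ g(t - r) dr produced here cancels the contribution of g(0) b(t).
  have e2 := intervalIntegral.integral_mul_deriv_eq_deriv_mul (a := 0) (b := t)
    (fun s _ => hG s) (fun s _ => hd s) (hgt.intervalIntegrable _ _) (hc.intervalIntegrable _ _)
  rw [e1, e2, hZ, hb.integral_mul_pathConv hg hg' ⟨ht, le_rfl⟩]
  simp [pow_two]
  ring

lemma IsBrownianCov.eLpNorm_pathConv_sq_le (hb : IsBrownianCov P b) {g g' : ℝ → ℝ}
    (hg : ∀ t, HasDerivAt g (g' t) t) (hg' : Continuous g') {t T M : ℝ} (ht : t ∈ Icc 0 T)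
    (hM : ∀ s ∈ Icc 0 T, g s ^ 2 ≤ M) :
    eLpNorm (fun ω => pathConv g g' (fun s => b s ω) t) 2 P ^ 2 ≤ ENNReal.ofReal (T * M) := by
  have cg : Continuous g := continuous_iff_continuousAt.2 fun t => (hg t).continuousAt
  rw [eLpNorm_two_sq_eq_ofReal (hb.isLinearFunctional_pathConv hg' ht.1).1]
  simp_rw [Real.norm_eq_abs, sq_abs]
  rw [hb.integral_pathConv_sq hg hg' ht.1]
  refine ENNReal.ofReal_le_ofReal ?_
  have hM0 : 0 ≤ M := (sq_nonneg _).trans (hM t ht)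
  calc ∫ s in (0 : ℝ)..t, g (t - s) ^ 2 ≤ ∫ _ in (0 : ℝ)..t, M := by
        refine intervalIntegral.integral_mono_on ht.1
          ((by fun_prop : Continuous fun s => g (t - s) ^ 2).intervalIntegrable _ _)
          intervalIntegrable_const fun s hs => hM _ ⟨by linarith [hs.2], by linarith [hs.1, ht.2]⟩
    _ = t * M := by simp
    _ ≤ T * M := mul_le_mul_of_nonneg_right ht.2 hM0

end WienerIntegral

/-! ### Orthogonal series in L²(Ω; X) -/

lemma tsum_enorm_sq_ne_top {X : Type*} [NormedAddCommGroup X] {e : ℕ → X}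
    (he : Summable fun k => ‖e k‖ ^ 2) : ∑' k, ‖e k‖ₑ ^ 2 ≠ ∞ := by
  convert he.tsum_ofReal_ne_top using 3 with k
  rw [ENNReal.ofReal_pow (norm_nonneg _), ofReal_norm]

/-- Dominated convergence for orthogonal series. -/
lemma tendsto_tsum_mul_of_bounded {X ι : Type*} [NormedAddCommGroup X] {e : ℕ → X} {l : Filter ι} [l.IsCountablyGenerated]
    {d : ι → ℕ → ℝ≥0∞} {c : ℝ≥0∞} (hc : c ≠ ∞) (hd : ∀ᶠ s in l, ∀ k, d s k ≤ c)
    (hlim : ∀ k, Tendsto (fun s => d s k) l (𝓝 0)) (he : Summable fun k => ‖e k‖ ^ 2) :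
    Tendsto (fun s => ∑' k, d s k * ‖e k‖ₑ ^ 2) l (𝓝 0) := by
  simp_rw [← lintegral_count]
  have h := tendsto_lintegral_filter_of_dominated_convergence (μ := Measure.count) (l := l)
    (F := fun s k => d s k * ‖e k‖ₑ ^ 2) (f := fun _ => 0) (fun k => c * ‖e k‖ₑ ^ 2)
    (Eventually.of_forall fun _ => measurable_of_countable _)
    (hd.mono fun s hs => ae_of_all _ fun k => by gcongr; exact hs k) ?_
    (ae_of_all _ fun k => ?_)
  · simpa using h
  · rw [lintegral_count, ENNReal.tsum_mul_left]
    exact ENNReal.mul_ne_top hc (tsum_enorm_sq_ne_top he)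
  · simpa using ENNReal.Tendsto.mul_const (hlim k) (Or.inr (by simp : ‖e k‖ₑ ^ 2 ≠ ∞))

section Series

variable {Ω : Type*} {mΩ : MeasurableSpace Ω} {P : Measure Ω}
  {X : Type*} [NormedAddCommGroup X] [InnerProductSpace ℝ X] {a : ℕ → Ω → ℝ} {e : ℕ → X}

lemma memLp_sum_smul (ha : ∀ k, MemLp (a k) 2 P) (s : Finset ℕ) :
    MemLp (fun ω => ∑ k ∈ s, a k ω • e k) 2 P :=
  memLp_finsetSum s fun k _ =>
    (ContinuousLinearMap.toSpanSingleton ℝ (e k)).comp_memLp' (ha k)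

/-- The summands of `∑ₖ a k • e k` are orthogonal in `L²(Ω; X)` if the `a k` are in `L²(Ω)`. -/
lemma eLpNorm_sum_smul_sq (ha : ∀ k, MemLp (a k) 2 P)
    (horth : ∀ k l, k ≠ l → ∫ ω, a k ω * a l ω ∂P = 0) (s : Finset ℕ) :
    eLpNorm (fun ω => ∑ k ∈ s, a k ω • e k) 2 P ^ 2 =
      ∑ k ∈ s, eLpNorm (a k) 2 P ^ 2 * ‖e k‖ₑ ^ 2 := by
  have hR : ∀ k, eLpNorm (a k) 2 P ^ 2 * ‖e k‖ₑ ^ 2 =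
      ENNReal.ofReal ((∫ ω, a k ω * a k ω ∂P) * ‖e k‖ ^ 2) := fun k => by
    rw [eLpNorm_two_sq_eq_ofReal (ha k), ENNReal.ofReal_mul' (sq_nonneg _),
      ENNReal.ofReal_pow (norm_nonneg _), ofReal_norm]
    simp_rw [Real.norm_eq_abs, sq_abs, pow_two]
  rw [eLpNorm_two_sq_eq_ofReal (memLp_sum_smul ha s), Finset.sum_congr rfl fun k _ => hR k,
    ← ENNReal.ofReal_sum_of_nonneg fun k _ => mul_nonneg
      (integral_nonneg fun _ => mul_self_nonneg _) (sq_nonneg _)]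
  congr 1
  have hpt : ∀ ω, ‖∑ k ∈ s, a k ω • e k‖ ^ 2 =
      ∑ k ∈ s, ∑ l ∈ s, a k ω * a l ω * inner ℝ (e k) (e l) := fun ω => by
    rw [← real_inner_self_eq_norm_sq, sum_inner]
    refine Finset.sum_congr rfl fun k _ => ?_
    rw [inner_sum]
    refine Finset.sum_congr rfl fun l _ => ?_
    rw [real_inner_smul_left, real_inner_smul_right]
    ring
  have hi : ∀ k l, Integrable (fun ω => a k ω * a l ω * inner ℝ (e k) (e l)) P := fun k l =>
    (integrable_mul_of_memLp_two (ha k) (ha l)).mul_const _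
  simp_rw [hpt]
  rw [integral_finsetSum _ fun k _ => integrable_finsetSum _ fun l _ => hi k l]
  -- The off-diagonal terms vanish because of the scalar factors; nothing is assumed about the inner
  -- products of the `e k`.
  refine Finset.sum_congr rfl fun k hk => ?_
  rw [integral_finsetSum _ fun l _ => hi k l, Finset.sum_eq_single k]
  · rw [integral_mul_const, real_inner_self_eq_norm_sq]
  · intro l _ hl
    rw [integral_mul_const, horth k l hl.symm, zero_mul]
  · exact fun h => absurd hk h

/-- Bessel-type bound for a mean-square convergent orthogonal series. -/
lemma eLpNorm_sq_le_tsum (ha : ∀ k, MemLp (a k) 2 P)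
    (horth : ∀ k l, k ≠ l → ∫ ω, a k ω * a l ω ∂P = 0) {y : Ω → X} (hy : MemLp y 2 P)
    (hlim : Tendsto (fun n => eLpNorm (fun ω => ∑ k ∈ Finset.range n, a k ω • e k - y ω) 2 P)
      atTop (𝓝 0)) :
    eLpNorm y 2 P ^ 2 ≤ ∑' k, eLpNorm (a k) 2 P ^ 2 * ‖e k‖ₑ ^ 2 := by
  set A := ∑' k, eLpNorm (a k) 2 P ^ 2 * ‖e k‖ₑ ^ 2 with hA
  have hB : (A ^ (2⁻¹ : ℝ)) ^ 2 = A := by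
    rw [← ENNReal.rpow_mul_natCast]
    norm_num
  have hle : ∀ n, eLpNorm y 2 P ≤ A ^ (2⁻¹ : ℝ) +
      eLpNorm (fun ω => ∑ k ∈ Finset.range n, a k ω • e k - y ω) 2 P := by
    intro n
    have hS := memLp_sum_smul (e := e) ha (Finset.range n)
    have h1 : y = (fun ω => ∑ k ∈ Finset.range n, a k ω • e k) -
        (fun ω => ∑ k ∈ Finset.range n, a k ω • e k - y ω) := by
      ext ω; simp
    have h2 := eLpNorm_sub_le hS.1 (hS.1.sub hy.1) one_le_two
    have h3 : eLpNorm (fun ω => ∑ k ∈ Finset.range n, a k ω • e k) 2 P ≤ A ^ (2⁻¹ : ℝ) := by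
      rw [← ENNReal.pow_le_pow_left_iff two_ne_zero, hB, eLpNorm_sum_smul_sq ha horth]
      exact ENNReal.sum_le_tsum _
    calc eLpNorm y 2 P = _ := congrArg (fun f => eLpNorm f 2 P) h1
      _ ≤ _ := h2
      _ ≤ _ := add_le_add_left h3 _
  have hfin : eLpNorm y 2 P ≤ A ^ (2⁻¹ : ℝ) := by
    have h := (tendsto_const_nhds (x := A ^ (2⁻¹ : ℝ))).add hlim
    rw [add_zero] at h
    exact ge_of_tendsto h (Eventually.of_forall hle)
  calc eLpNorm y 2 P ^ 2 ≤ (A ^ (2⁻¹ : ℝ)) ^ 2 := by gcongr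
    _ = A := hB

/-- An orthogonal series with bounded coefficients converges in mean square, and its sum has a
version that is measurable with respect to any σ-algebra that makes the coefficients
measurable. -/
lemma exists_meanSquare_sum [CompleteSpace X] {m : MeasurableSpace Ω} (hm : m ≤ mΩ)
    (ham : ∀ k, StronglyMeasurable[m] (a k)) {c : ℝ≥0∞} (hc : c ≠ ∞)
    (hac : ∀ k, eLpNorm (a k) 2 P ^ 2 ≤ c)
    (horth : ∀ k l, k ≠ l → ∫ ω, a k ω * a l ω ∂P = 0) (he : Summable fun k => ‖e k‖ ^ 2) :
    ∃ y : Ω → X, StronglyMeasurable[m] y ∧ MemLp y 2 P ∧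
      Tendsto (fun n => eLpNorm (fun ω => ∑ k ∈ Finset.range n, a k ω • e k - y ω) 2 P)
        atTop (𝓝 0) := by
  have ha : ∀ k, MemLp (a k) 2 P := fun k => by
    refine ⟨((ham k).mono hm).aestronglyMeasurable, ?_⟩
    by_contra h
    rw [not_lt_top_iff] at h
    have := hac k
    rw [h, ENNReal.top_pow two_ne_zero, top_le_iff] at this
    exact hc this
  have hSm : ∀ s : Finset ℕ, StronglyMeasurable[m] (fun ω => ∑ k ∈ s, a k ω • e k) := fun s =>
    Finset.stronglyMeasurable_fun_sum s fun k _ => (ham k).smul_const (e k)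
  -- The Cauchy limit is taken in L² of the trimmed measure, so that its representative is
  -- measurable for the smaller σ-algebra.
  have hSt : ∀ n, MemLp (fun ω => ∑ k ∈ Finset.range n, a k ω • e k) 2 (P.trim hm) := fun n =>
    ⟨(hSm _).aestronglyMeasurable, by
      rw [eLpNorm_trim hm (hSm _)]
      exact (memLp_sum_smul ha _).2⟩
  set S : ℕ → Lp X 2 (P.trim hm) := fun n => (hSt n).toLp _ with hS
  have hcau : CauchySeq S := by
    rw [EMetric.cauchySeq_iff']
    intro ε hε
    have ht := ENNReal.Tendsto.const_mul
      (ENNReal.tendsto_sum_nat_add _ (tsum_enorm_sq_ne_top he)) (Or.inr hc)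
    rw [mul_zero] at ht
    obtain ⟨N, hN⟩ := (ht.eventually (gt_mem_nhds (ENNReal.pow_pos hε 2))).exists
    refine ⟨N, fun n hn => ?_⟩
    rw [← ENNReal.pow_lt_pow_left_iff two_ne_zero, hS, Lp.edist_toLp_toLp]
    have hd : ((fun ω => ∑ k ∈ Finset.range n, a k ω • e k) -
        fun ω => ∑ k ∈ Finset.range N, a k ω • e k) =
        fun ω => ∑ k ∈ Finset.Ico N n, a k ω • e k := by
      ext ω
      simp only [Pi.sub_apply]
      rw [Finset.sum_Ico_eq_sub _ hn]
    rw [hd, eLpNorm_trim hm (hSm _), eLpNorm_sum_smul_sq ha horth]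
    refine lt_of_le_of_lt ?_ hN
    calc ∑ k ∈ Finset.Ico N n, eLpNorm (a k) 2 P ^ 2 * ‖e k‖ₑ ^ 2
        ≤ ∑ k ∈ Finset.Ico N n, c * ‖e k‖ₑ ^ 2 := by
          gcongr with k
          exact hac k
      _ = c * ∑ k ∈ Finset.range (n - N), ‖e (k + N)‖ₑ ^ 2 := by
          rw [← Finset.mul_sum, Finset.sum_Ico_eq_sum_range]
          simp_rw [add_comm N]
      _ ≤ c * ∑' k, ‖e (k + N)‖ₑ ^ 2 := by
          gcongr
          exact ENNReal.sum_le_tsum _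
  obtain ⟨y, hy⟩ := cauchySeq_tendsto_of_complete hcau
  have hym : StronglyMeasurable[m] (y : Ω → X) := Lp.stronglyMeasurable y
  refine ⟨y, hym, ⟨(hym.mono hm).aestronglyMeasurable, ?_⟩, ?_⟩
  · rw [← eLpNorm_trim hm hym]
    exact (Lp.memLp y).2
  · have h := (Lp.tendsto_Lp_iff_tendsto_eLpNorm' _ _).1 hy
    refine h.congr fun n => ?_
    exact (eLpNorm_congr_ae ((hSt n).coeFn_toLp.sub (ae_eq_refl _))).trans
      (eLpNorm_trim hm ((hSm (Finset.range n)).sub hym))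

end Series

/-! ### Mean-square estimates for one mode -/

/-- The solution of the oscillator equation driven by `b`. -/
noncomputable def oscPosition {Ω : Type*} (b : ℝ → Ω → ℝ) (μ lam t : ℝ) (ω : Ω) : ℝ :=
  pathConv (impulse μ lam) (impulseDeriv μ lam) (fun s => b s ω) t

/-- The velocity of the solution of the oscillator equation driven by `b`. -/
noncomputable def oscVelocity {Ω : Type*} (b : ℝ → Ω → ℝ) (μ lam t : ℝ) (ω : Ω) : ℝ :=
  pathConv (impulseDeriv μ lam) (impulseDeriv₂ μ lam) (fun s => b s ω) t

lemma exists_eLpNorm_le_of_sq_bound {Ω : Type*} {mΩ : MeasurableSpace Ω} {P : Measure Ω}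
    {ξ : ℝ → Ω → ℝ} {T K : ℝ}
    (h : ∀ t ∈ Icc 0 T, eLpNorm (ξ t) 2 P ^ 2 ≤ ENNReal.ofReal K) :
    ∃ c : ℝ≥0∞, c ≠ ∞ ∧ ∀ t ∈ Icc 0 T, eLpNorm (ξ t) 2 P ≤ c := by
  refine ⟨ENNReal.ofReal K ^ (2⁻¹ : ℝ), by finiteness, fun t ht =>
    le_rpow_of_sq_le (h t ht)⟩

section Estimates

variable {Ω : Type*} {b : ℝ → Ω → ℝ}

lemma continuous_oscPosition (hb : ∀ ω, Continuous fun s => b s ω) (μ lam : ℝ) (ω : Ω) :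
    Continuous fun t => oscPosition b μ lam t ω :=
  continuous_pathConv_impulse (hb ω) μ lam

lemma continuous_oscVelocity (hb : ∀ ω, Continuous fun s => b s ω) (μ lam : ℝ) (ω : Ω) :
    Continuous fun t => oscVelocity b μ lam t ω :=
  continuous_pathConv_impulseDeriv (hb ω) μ lam

lemma stronglyMeasurable_pathConv {m : MeasurableSpace Ω} (hb : ∀ ω, Continuous fun s => b s ω)
    (hm : ∀ s, StronglyMeasurable[m] (b s)) {g g' : ℝ → ℝ} (hg' : Continuous g') (t : ℝ) :
    StronglyMeasurable[m] fun ω => pathConv g g' (fun s => b s ω) t := by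
  have hc : StronglyMeasurable (Function.uncurry fun s ω => g' (t - s) * b s ω) :=
    stronglyMeasurable_uncurry_of_continuous_of_stronglyMeasurable
      (fun ω => by have := hb ω; fun_prop) (fun s => (hm s).const_mul _)
  have hK : ∀ A : Set ℝ, StronglyMeasurable[m] fun ω => ∫ s in A, g' (t - s) * b s ω := fun A =>
    StronglyMeasurable.integral_prod_right' (f := fun p : Ω × ℝ => g' (t - p.2) * b p.2 p.1)
      (hc.comp_measurable measurable_swap)
  exact ((hm t).const_mul (g 0)).add ((hK (Ioc 0 t)).sub (hK (Ioc t 0)))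

/-- `∫₀ᵗ g(t - s) db(s)` is measurable with respect to the past of `b` up to time `t`. -/
lemma stronglyMeasurable_pathConv_of_past {m : MeasurableSpace Ω}
    (hb : ∀ ω, Continuous fun s => b s ω) {t : ℝ} (ht : 0 ≤ t)
    (hm : ∀ s ∈ Icc 0 t, StronglyMeasurable[m] (b s)) {g g' : ℝ → ℝ} (hg' : Continuous g') :
    StronglyMeasurable[m] fun ω => pathConv g g' (fun s => b s ω) t := by
  -- Clamping the time to [0, t] leaves the convolution at t unchanged and makes every value of the
  -- path measurable with respect to the past.
  have h := stronglyMeasurable_pathConv (b := fun s => b (max 0 (min s t))) (g := g)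
    (fun ω => by have := hb ω; fun_prop)
    (fun s => hm _ ⟨le_max_left _ _, max_le ht (min_le_right _ _)⟩) hg' t
  convert h using 2 with ω
  simp only [pathConv, min_self, max_eq_right ht]
  congr 1
  refine intervalIntegral.integral_congr fun s hs => ?_
  rw [uIcc_of_le ht] at hs
  simp only [min_eq_left hs.2, max_eq_right hs.1]

variable {mΩ : MeasurableSpace Ω} {P : Measure Ω}

lemma IsBrownianCov.stronglyMeasurable_oscPosition (hb : IsBrownianCov P b) (μ lam t : ℝ) :
    StronglyMeasurable (oscPosition b μ lam t) :=
  stronglyMeasurable_pathConv hb.cont (fun s => (hb.meas s).stronglyMeasurable)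
    (continuous_impulseDeriv μ lam) t

lemma IsBrownianCov.stronglyMeasurable_oscVelocity (hb : IsBrownianCov P b) (μ lam t : ℝ) :
    StronglyMeasurable (oscVelocity b μ lam t) :=
  stronglyMeasurable_pathConv hb.cont (fun s => (hb.meas s).stronglyMeasurable)
    (continuous_impulseDeriv₂ μ lam) t

variable [IsProbabilityMeasure P]

lemma IsBrownianCov.isLinearFunctional_oscPosition (hb : IsBrownianCov P b) (μ lam : ℝ) {t : ℝ}
    (ht : 0 ≤ t) : IsLinearFunctional P b (oscPosition b μ lam t) :=
  hb.isLinearFunctional_pathConv (continuous_impulseDeriv μ lam) ht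

lemma IsBrownianCov.isLinearFunctional_oscVelocity (hb : IsBrownianCov P b) (μ lam : ℝ) {t : ℝ}
    (ht : 0 ≤ t) : IsLinearFunctional P b (oscVelocity b μ lam t) :=
  hb.isLinearFunctional_pathConv (continuous_impulseDeriv₂ μ lam) ht

lemma IsBrownianCov.eLpNorm_oscPosition_sq_le (hb : IsBrownianCov P b) {μ lam t T M : ℝ}
    (ht : t ∈ Icc 0 T) (hM : ∀ s ∈ Icc 0 T, impulse μ lam s ^ 2 ≤ M) :
    eLpNorm (oscPosition b μ lam t) 2 P ^ 2 ≤ ENNReal.ofReal (T * M) :=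
  hb.eLpNorm_pathConv_sq_le (hasDerivAt_impulse μ lam) (continuous_impulseDeriv μ lam) ht hM

lemma IsBrownianCov.eLpNorm_oscVelocity_sq_le (hb : IsBrownianCov P b) {μ lam t T M : ℝ}
    (ht : t ∈ Icc 0 T) (hM : ∀ s ∈ Icc 0 T, impulseDeriv μ lam s ^ 2 ≤ M) :
    eLpNorm (oscVelocity b μ lam t) 2 P ^ 2 ≤ ENNReal.ofReal (T * M) :=
  hb.eLpNorm_pathConv_sq_le (hasDerivAt_impulseDeriv μ lam) (continuous_impulseDeriv₂ μ lam) ht hM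

/-- The velocity is mean-square continuous. -/
lemma IsBrownianCov.tendsto_eLpNorm_oscVelocity_sub (hb : IsBrownianCov P b) (μ lam : ℝ) {t T : ℝ}
    (ht : t ∈ Icc 0 T) :
    Tendsto (fun r => eLpNorm (fun ω => oscVelocity b μ lam r ω - oscVelocity b μ lam t ω) 2 P)
      (𝓝[Icc 0 T] t) (𝓝 0) := by
  obtain ⟨M₁, h₁⟩ := (isCompact_Icc (a := (0 : ℝ)) (b := T)).bddAbove_image
    ((continuous_impulse μ lam).pow 2).continuousOn
  obtain ⟨M₂, h₂⟩ := (isCompact_Icc (a := (0 : ℝ)) (b := T)).bddAbove_image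
    ((continuous_impulseDeriv μ lam).pow 2).continuousOn
  obtain ⟨c₁, hc₁, hX⟩ := exists_eLpNorm_le_of_sq_bound fun r hr =>
    hb.eLpNorm_oscPosition_sq_le (μ := μ) (lam := lam) hr fun s hs => h₁ (mem_image_of_mem _ hs)
  obtain ⟨c₂, hc₂, hV⟩ := exists_eLpNorm_le_of_sq_bound fun r hr =>
    hb.eLpNorm_oscVelocity_sq_le (μ := μ) (lam := lam) hr fun s hs => h₂ (mem_image_of_mem _ hs)
  set c := ‖μ‖ₑ * c₂ + ‖lam‖ₑ * c₁ with hc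
  have hc_top : c ≠ ∞ := by finiteness
  have hξm : StronglyMeasurable (Function.uncurry fun r ω =>
      μ * oscVelocity b μ lam r ω - lam * oscPosition b μ lam r ω) := by
    refine stronglyMeasurable_uncurry_of_continuous_of_stronglyMeasurable (fun ω => ?_) fun r => ?_
    · have := continuous_oscPosition hb.cont μ lam ω
      have := continuous_oscVelocity hb.cont μ lam ω
      fun_prop
    · exact ((hb.stronglyMeasurable_oscVelocity μ lam r).const_mul μ).sub
        ((hb.stronglyMeasurable_oscPosition μ lam r).const_mul lam)
  have hξ : ∀ r ∈ Icc 0 T, eLpNorm (fun ω =>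
      μ * oscVelocity b μ lam r ω - lam * oscPosition b μ lam r ω) 2 P ≤ c := by
    intro r hr
    have m1 := (hb.isLinearFunctional_oscPosition μ lam hr.1).1.const_mul lam
    have m2 := (hb.isLinearFunctional_oscVelocity μ lam hr.1).1.const_mul μ
    refine (eLpNorm_sub_le m2.1 m1.1 one_le_two).trans (add_le_add ?_ ?_)
    · refine (eLpNorm_const_smul μ (oscVelocity b μ lam r) 2 P).trans_le ?_
      gcongr
      exact hV r hr
    · refine (eLpNorm_const_smul lam (oscPosition b μ lam r) 2 P).trans_le ?_
      gcongr
      exact hX r hr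
  -- The first term bounds the drift integral, the second is the exact L² norm of the noise
  -- increment.
  have hle : ∀ r ∈ Icc 0 T,
      eLpNorm (fun ω => oscVelocity b μ lam r ω - oscVelocity b μ lam t ω) 2 P ≤
        ENNReal.ofReal |r - t| * c + ENNReal.ofReal |r - t| ^ (2⁻¹ : ℝ) := by
    intro r hr
    have hsub : uIcc t r ⊆ Icc 0 T := ordConnected_Icc.uIcc_subset ht hr
    have hi := eLpNorm_two_intervalIntegral_le (P := P) hξm fun q hq => hξ q (hsub hq)
    have hbr : eLpNorm (fun ω => b r ω - b t ω) 2 P = ENNReal.ofReal |r - t| ^ (2⁻¹ : ℝ) := by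
      rw [← hb.eLpNorm_sub_sq ht.1 hr.1, ← ENNReal.rpow_natCast_mul]
      norm_num
    have hE : (fun ω => oscVelocity b μ lam r ω - oscVelocity b μ lam t ω) =
        (fun ω => ∫ q in t..r, (μ * oscVelocity b μ lam q ω - lam * oscPosition b μ lam q ω)) +
          fun ω => b r ω - b t ω :=
      funext fun ω => pathConv_impulseDeriv_sub (hb.cont ω) μ lam t r
    have hmI : AEStronglyMeasurable (fun ω => ∫ q in t..r,
        (μ * oscVelocity b μ lam q ω - lam * oscPosition b μ lam q ω)) P := by
      have h := ((hb.isLinearFunctional_oscVelocity μ lam hr.1).1.sub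
        (hb.isLinearFunctional_oscVelocity μ lam ht.1).1).sub ((hb.memLp r).sub (hb.memLp t))
      refine h.1.congr (ae_of_all _ fun ω => ?_)
      have := congrFun hE ω
      simp only [Pi.add_apply, Pi.sub_apply] at this ⊢
      rw [this, add_sub_cancel_right]
    rw [hE]
    refine (eLpNorm_add_le hmI ((hb.memLp r).sub (hb.memLp t)).1 one_le_two).trans ?_
    rw [← hbr]
    exact add_le_add hi le_rfl
  have hlim : Tendsto (fun r => ENNReal.ofReal |r - t| * c + ENNReal.ofReal |r - t| ^ (2⁻¹ : ℝ))
      (𝓝[Icc 0 T] t) (𝓝 0) := by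
    have h0 : Tendsto (fun r => ENNReal.ofReal |r - t|) (𝓝[Icc 0 T] t) (𝓝 0) := by
      have : Continuous fun r => ENNReal.ofReal |r - t| :=
        ENNReal.continuous_ofReal.comp (by fun_prop)
      simpa using (this.tendsto t).mono_left nhdsWithin_le_nhds
    have h1 := ENNReal.Tendsto.mul_const h0 (Or.inr hc_top)
    have h2 := h0.ennrpow_const (2⁻¹ : ℝ)
    have h3 := h1.add h2
    rwa [zero_mul, ENNReal.zero_rpow_of_pos (by norm_num), add_zero] at h3
  exact tendsto_of_tendsto_of_tendsto_of_le_of_le' tendsto_const_nhds hlim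
    (Eventually.of_forall fun _ => zero_le)
    (eventually_mem_nhdsWithin.mono hle)

/-- The error of the difference quotient is an average of increments of the velocity. -/
lemma IsBrownianCov.eLpNorm_slope_sub_le (hb : IsBrownianCov P b) (μ lam : ℝ) {s t : ℝ}
    (hst : s ≠ t) {c : ℝ≥0∞} (hc : ∀ r ∈ uIcc t s,
      eLpNorm (fun ω => oscVelocity b μ lam r ω - oscVelocity b μ lam t ω) 2 P ≤ c) :
    eLpNorm (fun ω => (s - t)⁻¹ * (oscPosition b μ lam s ω - oscPosition b μ lam t ω)
      - oscVelocity b μ lam t ω) 2 P ≤ c := by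
  have hne : s - t ≠ 0 := sub_ne_zero.2 hst
  have hξm : StronglyMeasurable (Function.uncurry fun r ω =>
      oscVelocity b μ lam r ω - oscVelocity b μ lam t ω) := by
    refine stronglyMeasurable_uncurry_of_continuous_of_stronglyMeasurable (fun ω => ?_) fun r => ?_
    · have := continuous_oscVelocity hb.cont μ lam ω
      fun_prop
    · exact (hb.stronglyMeasurable_oscVelocity μ lam r).sub
        (hb.stronglyMeasurable_oscVelocity μ lam t)
  have hE : (fun ω => (s - t)⁻¹ * (oscPosition b μ lam s ω - oscPosition b μ lam t ω)
      - oscVelocity b μ lam t ω) = (s - t)⁻¹ • fun ω => ∫ r in t..s,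
        (oscVelocity b μ lam r ω - oscVelocity b μ lam t ω) := by
    ext ω
    have h := integral_pathConv_impulseDeriv (hb.cont ω) μ lam t s
    rw [Pi.smul_apply, intervalIntegral.integral_sub
      ((continuous_oscVelocity hb.cont μ lam ω).intervalIntegrable _ _) intervalIntegrable_const,
      intervalIntegral.integral_const]
    simp only [oscVelocity, oscPosition, smul_eq_mul] at h ⊢
    rw [h]
    field_simp
  rw [hE, eLpNorm_const_smul]
  calc ‖(s - t)⁻¹‖ₑ * eLpNorm (fun ω => ∫ r in t..s,
        (oscVelocity b μ lam r ω - oscVelocity b μ lam t ω)) 2 P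
      ≤ ‖(s - t)⁻¹‖ₑ * (ENNReal.ofReal |s - t| * c) := by
        gcongr
        exact eLpNorm_two_intervalIntegral_le hξm hc
    _ = c := by
        rw [← mul_assoc, ← Real.norm_eq_abs, ofReal_norm, ← enorm_mul, inv_mul_cancel₀ hne]
        simp

/-- The difference quotients of the position converge to the velocity in mean square. -/
lemma IsBrownianCov.tendsto_eLpNorm_slope_sub (hb : IsBrownianCov P b) (μ lam : ℝ) {t T : ℝ}
    (ht : t ∈ Icc 0 T) :
    Tendsto (fun s => eLpNorm (fun ω => (s - t)⁻¹ *
        (oscPosition b μ lam s ω - oscPosition b μ lam t ω) - oscVelocity b μ lam t ω) 2 P)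
      (𝓝[Icc 0 T \ {t}] t) (𝓝 0) := by
  rw [ENNReal.tendsto_nhds_zero]
  intro ε hε
  have h := ENNReal.tendsto_nhds_zero.1 (hb.tendsto_eLpNorm_oscVelocity_sub μ lam ht) ε hε
  obtain ⟨δ, hδ, hsub⟩ := Metric.mem_nhdsWithin_iff.1 h
  refine mem_of_superset (inter_mem (mem_nhdsWithin_of_mem_nhds (Metric.ball_mem_nhds t hδ))
    self_mem_nhdsWithin) ?_
  rintro s ⟨hs, hsT, hst⟩
  -- Every r between t and s lies in the same ball around t and in [0, T], so ε bounds all the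
  -- averaged increments.
  refine hb.eLpNorm_slope_sub_le μ lam hst fun r hr => hsub ⟨?_, ?_⟩
  · exact (convex_ball t δ).ordConnected.uIcc_subset (Metric.mem_ball_self hδ) hs hr
  · exact ordConnected_Icc.uIcc_subset ht hsT hr

end Estimates

/-! ### A version of the noise with all paths continuous -/

section Noise

variable {Ω : Type*} {mΩ : MeasurableSpace Ω} {P : Measure Ω} {w w' : ℝ≥0 → Ω → ℝ}

open Classical in
/-- The noise, set to `0` on the null set of discontinuous paths and indexed by `ℝ`. -/
noncomputable def regularNoise (w : ℝ≥0 → Ω → ℝ) (s : ℝ) (ω : Ω) : ℝ :=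
  if Continuous (fun t => w t ω) then w s.toNNReal ω else 0

lemma continuous_regularNoise (w : ℝ≥0 → Ω → ℝ) (ω : Ω) :
    Continuous fun s => regularNoise w s ω := by
  by_cases h : Continuous fun t => w t ω
  · simp only [regularNoise, h, if_true]
    exact h.comp continuous_real_toNNReal
  · simp only [regularNoise, h, if_false]
    exact continuous_const

lemma ae_regularNoise_eq (hw : IsBrownianReal w P) :
    ∀ᵐ ω ∂P, ∀ s, regularNoise w s ω = w s.toNNReal ω :=
  hw.cont.mono fun ω h s => by simp only [regularNoise, h, if_true]

/-- Completeness puts the null set of discontinuous paths in F 0, so modifying the noise there keeps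
it adapted. -/
lemma stronglyMeasurable_regularNoise {F : Filtration ℝ≥0 mΩ} (hF : UsualConditions F P)
    (hw : IsBrownianReal w P) (hadapt : StronglyAdapted F w) {s : ℝ} {t : ℝ≥0}
    (hst : s.toNNReal ≤ t) : StronglyMeasurable[F t] (regularNoise w s) := by
  have hN : MeasurableSet[F t] {ω | Continuous fun t => w t ω} := by
    have h := F.mono (zero_le : 0 ≤ t) _ (hF.complete _ hw.cont)
    simpa [compl_def] using h.compl
  exact StronglyMeasurable.ite hN ((hadapt _).mono (F.mono hst)) stronglyMeasurable_const

lemma isBrownianCov_regularNoise [IsProbabilityMeasure P] {F : Filtration ℝ≥0 mΩ}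
    (hF : UsualConditions F P) (hw : IsBrownianReal w P) (hadapt : StronglyAdapted F w) :
    IsBrownianCov P (regularNoise w) := by
  have hae : ∀ s, regularNoise w s =ᵐ[P] w s.toNNReal := fun s =>
    (ae_regularNoise_eq hw).mono fun ω h => h s
  have hL : ∀ t, MemLp (w t) 2 P := fun t =>
    (hw.isGaussianProcess.hasGaussianLaw_eval t).memLp_two
  refine ⟨continuous_regularNoise w, fun s =>
    ((stronglyMeasurable_regularNoise hF hw hadapt (le_refl s.toNNReal)).mono (F.le _)).measurable,
    fun s => (hL _).ae_eq (hae s).symm, fun s r hs hr => ?_⟩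
  have h1 : ∫ ω, regularNoise w s ω * regularNoise w r ω ∂P =
      ∫ ω, w s.toNNReal ω * w r.toNNReal ω ∂P := integral_congr_ae ((hae s).mul (hae r))
  have h2 := covariance_eq_sub (hL s.toNNReal) (hL r.toNNReal)
  rw [hw.covariance_eval, hw.integral_eval, hw.integral_eval, mul_zero, sub_zero] at h2
  rw [h1]
  refine Eq.trans h2.symm ?_
  rw [NNReal.coe_min, Real.coe_toNNReal s hs, Real.coe_toNNReal r hr]

lemma integral_regularNoise_mul_eq_zero (hw : IsBrownianReal w P) (hw' : IsBrownianReal w' P)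
    (hind : IndepFun (fun ω t => w t ω) (fun ω t => w' t ω) P) (s r : ℝ) :
    ∫ ω, regularNoise w s ω * regularNoise w' r ω ∂P = 0 := by
  have h1 : ∫ ω, regularNoise w s ω * regularNoise w' r ω ∂P =
      ∫ ω, w s.toNNReal ω * w' r.toNNReal ω ∂P :=
    integral_congr_ae (by
      filter_upwards [ae_regularNoise_eq hw, ae_regularNoise_eq hw'] with ω h h'
      rw [h, h'])
  have h2 : IndepFun (w s.toNNReal) (w' r.toNNReal) P :=
    hind.comp (measurable_pi_apply s.toNNReal) (measurable_pi_apply r.toNNReal)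
  rw [h1, h2.integral_fun_mul_eq_mul_integral (hw.integrable_eval _).1 (hw'.integrable_eval _).1,
    hw.integral_eval, zero_mul]

end Noise

/-! ### Existence and pathwise uniqueness for one mode -/

section Oscillator

variable {Ω : Type*} {mΩ : MeasurableSpace Ω} {P : Measure Ω} {w : ℝ≥0 → Ω → ℝ}
  {F : Filtration ℝ≥0 mΩ} {T : ℝ≥0} {μ lam : ℝ}

lemma oscPosition_eq_integral {b : ℝ → Ω → ℝ} (hb : ∀ ω, Continuous fun s => b s ω) (t : ℝ)
    (ω : Ω) : oscPosition b μ lam t ω = ∫ s in (0 : ℝ)..t, oscVelocity b μ lam s ω := by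
  have h := integral_pathConv_impulseDeriv (hb ω) μ lam 0 t
  rw [pathConv_zero, impulse_zero, zero_mul, sub_zero] at h
  exact h.symm

lemma oscVelocity_eq_integral {b : ℝ → Ω → ℝ} (hb : ∀ ω, Continuous fun s => b s ω) (t : ℝ)
    (ω : Ω) : oscVelocity b μ lam t ω =
      (∫ s in (0 : ℝ)..t, (μ * oscVelocity b μ lam s ω - lam * oscPosition b μ lam s ω)) +
        b t ω := by
  have h := pathConv_impulseDeriv_sub (hb ω) μ lam 0 t
  rw [pathConv_zero, impulseDeriv_zero, one_mul] at h
  simp only [oscVelocity, oscPosition]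
  linarith

lemma isDampedOscillator_regularNoise (hF : UsualConditions F P) (hw : IsBrownianReal w P)
    (hadapt : StronglyAdapted F w) :
    IsDampedOscillator F P T w μ lam (fun t => oscPosition (regularNoise w) μ lam t)
      (fun t => oscVelocity (regularNoise w) μ lam t) := by
  have hc := continuous_regularNoise w
  have hm : ∀ t : ℝ≥0, ∀ s ∈ Icc (0 : ℝ) t, StronglyMeasurable[F t] (regularNoise w s) :=
    fun t s hs => stronglyMeasurable_regularNoise hF hw hadapt (Real.toNNReal_le_iff_le_coe.2 hs.2)
  refine ⟨fun t _ => stronglyMeasurable_pathConv_of_past hc t.2 (hm t)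
      (continuous_impulseDeriv μ lam),
    fun t _ => stronglyMeasurable_pathConv_of_past hc t.2 (hm t) (continuous_impulseDeriv₂ μ lam),
    ae_of_all _ fun ω => ((continuous_oscVelocity hc μ lam ω).comp
      NNReal.continuous_coe).continuousOn, ae_of_all _ fun ω t _ => ?_, ?_⟩
  · rw [oscPosition_eq_integral hc]
    refine intervalIntegral.integral_congr fun s hs => ?_
    rw [uIcc_of_le t.coe_nonneg] at hs
    simp only [Real.coe_toNNReal s hs.1]
  · filter_upwards [ae_regularNoise_eq hw] with ω hω t _
    rw [oscVelocity_eq_integral hc, hω, Real.toNNReal_coe]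
    congr 1
    refine intervalIntegral.integral_congr fun s hs => ?_
    rw [uIcc_of_le t.coe_nonneg] at hs
    simp only [Real.coe_toNNReal s hs.1]

/-- Pathwise uniqueness for the oscillator equation. -/
lemma IsDampedOscillator.ae_eq (hw : IsBrownianReal w P) {x v : ℝ≥0 → Ω → ℝ}
    (h : IsDampedOscillator F P T w μ lam x v) :
    ∀ᵐ ω ∂P, ∀ t ≤ T, x t ω = oscPosition (regularNoise w) μ lam t ω ∧
      v t ω = oscVelocity (regularNoise w) μ lam t ω := by
  have hc := continuous_regularNoise w
  filter_upwards [h.continuous_velocity, h.position_eq, h.velocity_eq, ae_regularNoise_eq hw]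
    with ω h1 h2 h3 h4
  -- The velocity is continuous only on [0, T]; freezing it at T gives a continuous function on the
  -- line. Its primitive `q` plays the same role for the position.
  set p : ℝ → ℝ := fun s => v (min s.toNNReal T) ω with hp
  have cp : Continuous p := h1.comp_continuous (by fun_prop) fun s =>
    mem_Iic.2 (min_le_right _ _)
  have hpv : ∀ s ∈ Icc (0 : ℝ) T, p s = v s.toNNReal ω := fun s hs => by
    simp only [hp, min_eq_left (Real.toNNReal_le_iff_le_coe.2 hs.2)]
  set q : ℝ → ℝ := fun t => ∫ s in (0 : ℝ)..t, p s with hq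
  have cq : Continuous q := intervalIntegral.continuous_primitive
    (fun a b => cp.intervalIntegrable a b) 0
  have hqx : ∀ s ∈ Icc (0 : ℝ) T, q s = x s.toNNReal ω := fun s hs => by
    rw [h2 _ (Real.toNNReal_le_iff_le_coe.2 hs.2), Real.coe_toNNReal s hs.1]
    refine intervalIntegral.integral_congr fun r hr => ?_
    rw [uIcc_of_le hs.1] at hr
    exact hpv r ⟨hr.1, hr.2.trans hs.2⟩
  have cx := continuous_oscPosition hc μ lam ω
  have cv := continuous_oscVelocity hc μ lam ω
  -- The noise cancels in the difference with the explicit solution, leaving the homogeneous system.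
  have key := oscillator_eq_zero (μ := μ) (lam := lam) (T := T)
    (x := fun s => q s - oscPosition (regularNoise w) μ lam s ω)
    (v := fun s => p s - oscVelocity (regularNoise w) μ lam s ω) (cp.sub cv)
    (fun t _ => by
      rw [intervalIntegral.integral_sub (cp.intervalIntegrable _ _) (cv.intervalIntegrable _ _),
        ← oscPosition_eq_integral hc])
    (fun t ht => by
      have e : ∀ s, μ * (p s - oscVelocity (regularNoise w) μ lam s ω) -
          lam * (q s - oscPosition (regularNoise w) μ lam s ω) = (μ * p s - lam * q s) -
          (μ * oscVelocity (regularNoise w) μ lam s ω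
            - lam * oscPosition (regularNoise w) μ lam s ω) := fun s => by ring
      simp_rw [e]
      rw [intervalIntegral.integral_sub
        ((by fun_prop : Continuous fun s => μ * p s - lam * q s).intervalIntegrable _ _)
        ((by fun_prop : Continuous fun s => μ * oscVelocity (regularNoise w) μ lam s ω
            - lam * oscPosition (regularNoise w) μ lam s ω).intervalIntegrable _ _),
        oscVelocity_eq_integral hc t ω, hpv t ht, h3 _ (Real.toNNReal_le_iff_le_coe.2 ht.2), h4,
        Real.coe_toNNReal t ht.1]
      have e2 : ∫ s in (0 : ℝ)..t, (μ * v s.toNNReal ω - lam * x s.toNNReal ω) =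
          ∫ s in (0 : ℝ)..t, (μ * p s - lam * q s) := by
        refine intervalIntegral.integral_congr fun s hs => ?_
        rw [uIcc_of_le ht.1] at hs
        have hs' : s ∈ Icc (0 : ℝ) T := ⟨hs.1, hs.2.trans ht.2⟩
        rw [hpv s hs', hqx s hs']
      rw [e2]
      ring)
  intro t ht
  have htI : (t : ℝ) ∈ Icc (0 : ℝ) T := ⟨t.2, NNReal.coe_le_coe.2 ht⟩
  obtain ⟨k1, k2⟩ := key t htI
  rw [hqx _ htI, Real.toNNReal_coe] at k1
  rw [hpv _ htI, Real.toNNReal_coe] at k2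
  exact ⟨sub_eq_zero.1 k1, sub_eq_zero.1 k2⟩

end Oscillator

/-! ### The X-valued solution and its mean-square derivative -/

section Solution

variable {Ω : Type*} {mΩ : MeasurableSpace Ω} {P : Measure Ω} [IsProbabilityMeasure P]
  {F : Filtration ℝ≥0 mΩ} {w : ℕ → ℝ≥0 → Ω → ℝ} {T : ℝ≥0} {μ lam : ℕ → ℝ}
  {x v : ℕ → ℝ≥0 → Ω → ℝ}

lemma IsIndepBrownian.isBrownianCov (hF : UsualConditions F P) (hw : IsIndepBrownian F P w)
    (k : ℕ) : IsBrownianCov P (regularNoise (w k)) :=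
  isBrownianCov_regularNoise hF (hw.brownian k) (hw.adapted k)

/-- Functionals of different components of the noise are orthogonal. -/
lemma IsIndepBrownian.integral_mul_eq_zero (hF : UsualConditions F P) (hw : IsIndepBrownian F P w)
    {a : ℕ → Ω → ℝ} (ha : ∀ k, IsLinearFunctional P (regularNoise (w k)) (a k)) (k l : ℕ)
    (hkl : k ≠ l) : ∫ ω, a k ω * a l ω ∂P = 0 :=
  (ha k).integral_mul_eq_zero (hw.isBrownianCov hF k).memLp (ha l) fun s r _ _ =>
    integral_regularNoise_mul_eq_zero (hw.brownian k) (hw.brownian l) (hw.indep.indepFun hkl) s r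

section Coefficients

variable (hF : UsualConditions F P) (hw : IsIndepBrownian F P w)
  (hosc : ∀ k, IsDampedOscillator F P T (w k) (μ k) (lam k) (x k) (v k))

include hw hosc

omit [IsProbabilityMeasure P] in
lemma position_ae_eq (k : ℕ) {t : ℝ≥0} (ht : t ≤ T) :
    x k t =ᵐ[P] oscPosition (regularNoise (w k)) (μ k) (lam k) t :=
  ((hosc k).ae_eq (hw.brownian k)).mono fun _ h => (h t ht).1

omit [IsProbabilityMeasure P] in
lemma velocity_ae_eq (k : ℕ) {t : ℝ≥0} (ht : t ≤ T) :
    v k t =ᵐ[P] oscVelocity (regularNoise (w k)) (μ k) (lam k) t :=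
  ((hosc k).ae_eq (hw.brownian k)).mono fun _ h => (h t ht).2

include hF

lemma isLinearFunctional_position (k : ℕ) {t : ℝ≥0} (ht : t ≤ T) :
    IsLinearFunctional P (regularNoise (w k)) (x k t) :=
  ((hw.isBrownianCov hF k).isLinearFunctional_oscPosition (μ k) (lam k) t.2).congr
    (position_ae_eq hw hosc k ht).symm

lemma isLinearFunctional_velocity (k : ℕ) {t : ℝ≥0} (ht : t ≤ T) :
    IsLinearFunctional P (regularNoise (w k)) (v k t) :=
  ((hw.isBrownianCov hF k).isLinearFunctional_oscVelocity (μ k) (lam k) t.2).congr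
    (velocity_ae_eq hw hosc k ht).symm

variable {X : Type*} [NormedAddCommGroup X] [InnerProductSpace ℝ X] [CompleteSpace X] {e : ℕ → X}

/-- The position series converges in mean square to an adapted process. -/
lemma exists_isMeanSquareSum_position (he : Summable fun k => ‖e k‖ ^ 2) {M : ℝ}
    (hM : ∀ k, ∀ t ∈ Icc (0 : ℝ) T, impulse (μ k) (lam k) t ^ 2 ≤ M) :
    ∃ u : ℝ≥0 → Ω → X, (∀ t ≤ T, StronglyMeasurable[F t] (u t)) ∧
      IsMeanSquareSum P T e x u := by
  -- The implication sits under the existential so that the chosen process is defined at all times,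
  -- with value 0 after T.
  have h : ∀ t : ℝ≥0, ∃ y : Ω → X, t ≤ T → StronglyMeasurable[F t] y ∧ MemLp y 2 P ∧
      Tendsto (fun n => eLpNorm (fun ω => partialSum e x n t ω - y ω) 2 P) atTop (𝓝 0) := by
    intro t
    by_cases ht : t ≤ T
    · obtain ⟨y, hy⟩ := exists_meanSquare_sum (P := P) (F.le t)
        (fun k => (hosc k).adapted_position t ht)
        (ENNReal.ofReal_ne_top (r := T * M))
        (fun k => by
          rw [eLpNorm_congr_ae (position_ae_eq hw hosc k ht)]
          exact (hw.isBrownianCov hF k).eLpNorm_oscPosition_sq_le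
            ⟨t.2, NNReal.coe_le_coe.2 ht⟩ (hM k))
        (hw.integral_mul_eq_zero hF fun k => isLinearFunctional_position hF hw hosc k ht) he
      exact ⟨y, fun _ => hy⟩
    · exact ⟨0, fun h => absurd h ht⟩
  choose u hu using h
  exact ⟨u, fun t ht => (hu t ht).1, fun t ht => (hu t ht).2⟩

/-- The velocity series converges in mean square to an adapted process. -/
lemma exists_isMeanSquareSum_velocity (he : Summable fun k => ‖e k‖ ^ 2) {M : ℝ}
    (hM : ∀ k, ∀ t ∈ Icc (0 : ℝ) T, impulseDeriv (μ k) (lam k) t ^ 2 ≤ M) :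
    ∃ y : ℝ≥0 → Ω → X, (∀ t ≤ T, StronglyMeasurable[F t] (y t)) ∧
      IsMeanSquareSum P T e v y := by
  have h : ∀ t : ℝ≥0, ∃ y : Ω → X, t ≤ T → StronglyMeasurable[F t] y ∧ MemLp y 2 P ∧
      Tendsto (fun n => eLpNorm (fun ω => partialSum e v n t ω - y ω) 2 P) atTop (𝓝 0) := by
    intro t
    by_cases ht : t ≤ T
    · obtain ⟨y, hy⟩ := exists_meanSquare_sum (P := P) (F.le t)
        (fun k => (hosc k).adapted_velocity t ht)
        (ENNReal.ofReal_ne_top (r := T * M))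
        (fun k => by
          rw [eLpNorm_congr_ae (velocity_ae_eq hw hosc k ht)]
          exact (hw.isBrownianCov hF k).eLpNorm_oscVelocity_sq_le
            ⟨t.2, NNReal.coe_le_coe.2 ht⟩ (hM k))
        (hw.integral_mul_eq_zero hF fun k => isLinearFunctional_velocity hF hw hosc k ht) he
      exact ⟨y, fun _ => hy⟩
    · exact ⟨0, fun h => absurd h ht⟩
  choose u hu using h
  exact ⟨u, fun t ht => (hu t ht).1, fun t ht => (hu t ht).2⟩

omit [CompleteSpace X] in
lemma memLp_partialSum_position (n : ℕ) {t : ℝ≥0} (ht : t ≤ T) :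
    MemLp (partialSum e x n t) 2 P :=
  memLp_sum_smul (fun k => (isLinearFunctional_position hF hw hosc k ht).1) (Finset.range n)

omit [CompleteSpace X] in
lemma memLp_partialSum_velocity (n : ℕ) {t : ℝ≥0} (ht : t ≤ T) :
    MemLp (partialSum e v n t) 2 P :=
  memLp_sum_smul (fun k => (isLinearFunctional_velocity hF hw hosc k ht).1) (Finset.range n)

omit [CompleteSpace X] in
lemma tendstoInMeasure_of_isMeanSquareSum {u : ℝ≥0 → Ω → X} (hu : IsMeanSquareSum P T e x u)
    {t : ℝ≥0} (ht : t ≤ T) :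
    TendstoInMeasure P (fun n => partialSum e x n t) atTop (u t) :=
  tendstoInMeasure_of_tendsto_eLpNorm two_ne_zero
    (fun n => (memLp_partialSum_position hF hw hosc n ht).1) (hu t ht).1.1 (hu t ht).2

/-- The difference quotients of a coefficient, as functionals of the noise. -/
lemma isLinearFunctional_slope_sub (k : ℕ) {s t : ℝ≥0} (hs : s ≤ T) (ht : t ≤ T) :
    IsLinearFunctional P (regularNoise (w k))
      (fun ω => ((s : ℝ) - t)⁻¹ * (x k s ω - x k t ω) - v k t ω) :=
  (((isLinearFunctional_position hF hw hosc k hs).sub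
    (isLinearFunctional_position hF hw hosc k ht)).const_mul _).sub
    (isLinearFunctional_velocity hF hw hosc k ht)

omit hF in
omit [IsProbabilityMeasure P] in
lemma slope_sub_ae_eq (k : ℕ) {s t : ℝ≥0} (hs : s ≤ T) (ht : t ≤ T) :
    (fun ω => ((s : ℝ) - t)⁻¹ * (x k s ω - x k t ω) - v k t ω) =ᵐ[P]
      fun ω => ((s : ℝ) - t)⁻¹ * (oscPosition (regularNoise (w k)) (μ k) (lam k) s ω
        - oscPosition (regularNoise (w k)) (μ k) (lam k) t ω)
        - oscVelocity (regularNoise (w k)) (μ k) (lam k) t ω := by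
  filter_upwards [position_ae_eq hw hosc k hs, position_ae_eq hw hosc k ht,
    velocity_ae_eq hw hosc k ht] with ω h1 h2 h3
  rw [h1, h2, h3]

lemma tendsto_eLpNorm_slope_sub (k : ℕ) {t : ℝ≥0} (ht : t ≤ T) :
    Tendsto (fun s : ℝ≥0 =>
      eLpNorm (fun ω => ((s : ℝ) - t)⁻¹ * (x k s ω - x k t ω) - v k t ω) 2 P)
      (𝓝[Iic T \ {t}] t) (𝓝 0) := by
  have h := (hw.isBrownianCov hF k).tendsto_eLpNorm_slope_sub (μ k) (lam k) (t := t) (T := T)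
    ⟨t.2, NNReal.coe_le_coe.2 ht⟩
  have hcoe : Tendsto (fun s : ℝ≥0 => (s : ℝ)) (𝓝[Iic T \ {t}] t)
      (𝓝[Icc (0 : ℝ) T \ {(t : ℝ)}] t) := by
    refine tendsto_nhdsWithin_of_tendsto_nhds_of_eventually_within _
      ((NNReal.continuous_coe.tendsto t).mono_left nhdsWithin_le_nhds) ?_
    filter_upwards [self_mem_nhdsWithin] with s hs
    exact ⟨⟨s.2, NNReal.coe_le_coe.2 hs.1⟩, fun h => hs.2 (NNReal.coe_injective h)⟩
  refine (h.comp hcoe).congr' ?_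
  filter_upwards [self_mem_nhdsWithin] with s hs
  exact (eLpNorm_congr_ae (slope_sub_ae_eq hw hosc k hs.1 ht)).symm

/-- The error averages increments of the velocity, so its norm is at most twice the uniform velocity
bound. This is the domination needed to pass to the limit under the sum over modes. -/
lemma exists_eLpNorm_slope_sub_sq_le {M : ℝ}
    (hM : ∀ k, ∀ t ∈ Icc (0 : ℝ) T, impulseDeriv (μ k) (lam k) t ^ 2 ≤ M) :
    ∃ c : ℝ≥0∞, c ≠ ∞ ∧ ∀ s ≤ T, ∀ t ≤ T, s ≠ t → ∀ k,
      eLpNorm (fun ω => ((s : ℝ) - t)⁻¹ * (x k s ω - x k t ω) - v k t ω) 2 P ^ 2 ≤ c := by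
  have hV : ∀ k, ∀ r ∈ Icc (0 : ℝ) T,
      eLpNorm (oscVelocity (regularNoise (w k)) (μ k) (lam k) r) 2 P ≤
        ENNReal.ofReal (T * M) ^ (2⁻¹ : ℝ) := fun k r hr =>
    le_rpow_of_sq_le ((hw.isBrownianCov hF k).eLpNorm_oscVelocity_sq_le hr (hM k))
  refine ⟨(ENNReal.ofReal (T * M) ^ (2⁻¹ : ℝ) + ENNReal.ofReal (T * M) ^ (2⁻¹ : ℝ)) ^ 2,
    by finiteness, fun s hs t ht hst k => ?_⟩
  have htI : (t : ℝ) ∈ Icc (0 : ℝ) T := ⟨t.2, NNReal.coe_le_coe.2 ht⟩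
  have hsI : (s : ℝ) ∈ Icc (0 : ℝ) T := ⟨s.2, NNReal.coe_le_coe.2 hs⟩
  rw [eLpNorm_congr_ae (slope_sub_ae_eq hw hosc k hs ht)]
  gcongr
  refine (hw.isBrownianCov hF k).eLpNorm_slope_sub_le _ _
    (fun h => hst (NNReal.coe_injective h)) fun r hr => ?_
  have hr' := ordConnected_Icc.uIcc_subset htI hsI hr
  exact (eLpNorm_sub_le
    ((hw.isBrownianCov hF k).isLinearFunctional_oscVelocity _ _ hr'.1).1.1
    ((hw.isBrownianCov hF k).isLinearFunctional_oscVelocity _ _ t.2).1.1 one_le_two).trans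
    (add_le_add (hV k r hr') (hV k t htI))

omit [CompleteSpace X] in
/-- The mean-square sum of the velocities is the mean-square derivative of the sum of the
positions. -/
lemma isMeanSquareDeriv_of_isMeanSquareSum (he : Summable fun k => ‖e k‖ ^ 2) {M : ℝ}
    (hM : ∀ k, ∀ t ∈ Icc (0 : ℝ) T, impulseDeriv (μ k) (lam k) t ^ 2 ≤ M)
    {u y : ℝ≥0 → Ω → X} (hu : IsMeanSquareSum P T e x u) (hy : IsMeanSquareSum P T e v y) :
    IsMeanSquareDeriv P T u y := by
  intro t ht
  set d : ℝ≥0 → ℕ → Ω → ℝ :=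
    fun s k ω => ((s : ℝ) - t)⁻¹ * (x k s ω - x k t ω) - v k t ω with hd
  obtain ⟨c, hc, hdc⟩ := exists_eLpNorm_slope_sub_sq_le hF hw hosc hM
  have hsum : Tendsto (fun s => ∑' k, eLpNorm (d s k) 2 P ^ 2 * ‖e k‖ₑ ^ 2)
      (𝓝[Iic T \ {t}] t) (𝓝 0) := by
    refine tendsto_tsum_mul_of_bounded hc ?_ (fun k => ?_) he
    · filter_upwards [self_mem_nhdsWithin] with s hs k
      exact hdc s hs.1 t ht hs.2 k
    · have h := tendsto_eLpNorm_slope_sub hF hw hosc k ht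
      have h2 := ((ENNReal.continuous_pow 2).tendsto 0).comp h
      rwa [zero_pow two_ne_zero] at h2
  have hle : ∀ᶠ s : ℝ≥0 in 𝓝[Iic T \ {t}] t,
      eLpNorm (fun ω => ((s : ℝ) - (t : ℝ))⁻¹ • (u s ω - u t ω) - y t ω) 2 P ^ 2 ≤
        ∑' k, eLpNorm (d s k) 2 P ^ 2 * ‖e k‖ₑ ^ 2 := by
    filter_upwards [self_mem_nhdsWithin] with s hs
    have hdl : ∀ k, IsLinearFunctional P (regularNoise (w k)) (d s k) := fun k =>
      isLinearFunctional_slope_sub hF hw hosc k hs.1 ht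
    refine eLpNorm_sq_le_tsum (fun k => (hdl k).1) (hw.integral_mul_eq_zero hF hdl)
      ((((hu s hs.1).1.sub (hu t ht).1).const_smul _).sub (hy t ht).1) ?_
    -- Here s is fixed and only n varies, so the factor 1/(s - t) is harmless: the error series
    -- converges in mean square, and its norm is then bounded termwise.
    have hbd : ∀ n, eLpNorm (fun ω => ∑ k ∈ Finset.range n, d s k ω • e k -
        (((s : ℝ) - (t : ℝ))⁻¹ • (u s ω - u t ω) - y t ω)) 2 P ≤
        ‖((s : ℝ) - t)⁻¹‖ₑ * (eLpNorm (fun ω => partialSum e x n s ω - u s ω) 2 P +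
          eLpNorm (fun ω => partialSum e x n t ω - u t ω) 2 P) +
          eLpNorm (fun ω => partialSum e v n t ω - y t ω) 2 P := by
      intro n
      have m1 := (memLp_partialSum_position (e := e) hF hw hosc n hs.1).sub (hu s hs.1).1
      have m2 := (memLp_partialSum_position (e := e) hF hw hosc n ht).sub (hu t ht).1
      have m3 := (memLp_partialSum_velocity (e := e) hF hw hosc n ht).sub (hy t ht).1
      have hE : (fun ω => ∑ k ∈ Finset.range n, d s k ω • e k -
          (((s : ℝ) - (t : ℝ))⁻¹ • (u s ω - u t ω) - y t ω)) =
          ((s : ℝ) - (t : ℝ))⁻¹ • ((partialSum e x n s - u s) - (partialSum e x n t - u t)) -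
            (partialSum e v n t - y t) := by
        ext ω
        simp only [hd, partialSum, Pi.sub_apply, Pi.smul_apply, sub_smul, mul_smul,
          Finset.sum_sub_distrib, smul_sub, Finset.smul_sum]
        abel
      rw [hE]
      refine (eLpNorm_sub_le ((m1.sub m2).const_smul _).1 m3.1 one_le_two).trans ?_
      rw [eLpNorm_const_smul]
      gcongr
      · exact eLpNorm_sub_le m1.1 m2.1 one_le_two
      · exact le_rfl
    refine tendsto_of_tendsto_of_tendsto_of_le_of_le tendsto_const_nhds ?_ (fun _ => zero_le) hbd
    have h1 := (ENNReal.Tendsto.const_mul (a := ‖((s : ℝ) - t)⁻¹‖ₑ)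
      ((hu s hs.1).2.add (hu t ht).2) (Or.inr enorm_ne_top)).add (hy t ht).2
    simpa using h1
  have hsq := tendsto_of_tendsto_of_tendsto_of_le_of_le' tendsto_const_nhds hsum
    (Eventually.of_forall fun _ => zero_le) hle
  have hrt := hsq.ennrpow_const (2⁻¹ : ℝ)
  rw [ENNReal.zero_rpow_of_pos (by norm_num)] at hrt
  refine hrt.congr fun s => ?_
  rw [← ENNReal.rpow_natCast_mul]
  norm_num

end Coefficients

end Solution

end StochHyp

/-! ### Assembly -/

theorem theorem2p1
    {H : Type*} [NormedAddCommGroup H] [InnerProductSpace ℝ H] [CompleteSpace H]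
    {X : Type*} [NormedAddCommGroup X] [InnerProductSpace ℝ X] [CompleteSpace X]
    [TopologicalSpace.SeparableSpace X]
    (h : HilbertBasis ℕ ℝ H)
    (j : H →L[ℝ] X) (hj_inj : Function.Injective j) (hj_dense : DenseRange j)
    (hj_HS : Summable fun k => ‖j (h k)‖ ^ 2)
    {Ω : Type*} {mΩ : MeasurableSpace Ω} (P : Measure Ω) [IsProbabilityMeasure P]
    (F : Filtration ℝ≥0 mΩ) (hF : StochHyp.UsualConditions F P)
    (w : ℕ → ℝ≥0 → Ω → ℝ) (hw : StochHyp.IsIndepBrownian F P w)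
    (T : ℝ≥0) (hT : 0 < T)
    (Θ₁ Θ₂ : Set ℝ) (hΘ₁ : IsCompact Θ₁) (hΘ₂ : IsCompact Θ₂)
    (θ₁ θ₂ : ℝ) (hθ₁ : θ₁ ∈ Θ₁) (hθ₂ : θ₂ ∈ Θ₂)
    (A₀ A₁ B₀ B₁ : H →ₗ.[ℝ] H) (κ τ ρ ν : ℕ → ℝ)
    (hdiag : StochHyp.IsDiagonalizable h A₀ A₁ B₀ B₁ κ τ ρ ν)
    (hhyp : StochHyp.IsHyperbolic Θ₁ Θ₂ T κ τ ρ ν) :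
    -- existence, with mean-square convergence of the expansion
    (∃ (u : ℝ≥0 → Ω → X) (x v : ℕ → ℝ≥0 → Ω → ℝ),
      StochHyp.IsGeneralizedSolution F P T w (fun k => j (h k))
        (fun k => ρ k + θ₂ * ν k) (fun k => κ k + θ₁ * τ k) u x v ∧
      StochHyp.IsMeanSquareSum P T (fun k => j (h k)) x u) ∧
    -- uniqueness, of the process and of its coefficients
    (∀ (u u' : ℝ≥0 → Ω → X) (x v x' v' : ℕ → ℝ≥0 → Ω → ℝ),
      StochHyp.IsGeneralizedSolution F P T w (fun k => j (h k))
        (fun k => ρ k + θ₂ * ν k) (fun k => κ k + θ₁ * τ k) u x v →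
      StochHyp.IsGeneralizedSolution F P T w (fun k => j (h k))
        (fun k => ρ k + θ₂ * ν k) (fun k => κ k + θ₁ * τ k) u' x' v' →
      (∀ t ≤ T, u t =ᵐ[P] u' t) ∧ ∀ k, ∀ᵐ ω ∂P, ∀ t ≤ T, x k t ω = x' k t ω) ∧
    -- the time derivative, under an upper bound on the dissipation eigenvalues
    ((∃ C₀ : ℝ, ∀ k, θ₂ * ν k + ρ k ≤ C₀) →
      ∀ (u : ℝ≥0 → Ω → X) (x v : ℕ → ℝ≥0 → Ω → ℝ),
        StochHyp.IsGeneralizedSolution F P T w (fun k => j (h k))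
          (fun k => ρ k + θ₂ * ν k) (fun k => κ k + θ₁ * τ k) u x v →
        ∃ y : ℝ≥0 → Ω → X, (∀ t ≤ T, StronglyMeasurable[F t] (y t)) ∧
          StochHyp.IsMeanSquareSum P T (fun k => j (h k)) v y ∧
          StochHyp.IsMeanSquareDeriv P T u y) := by
  have hT' : (0 : ℝ) < T := hT
  have hlam := hhyp.tendsto_atTop hθ₁
  obtain ⟨C, -, J, hJ⟩ := hhyp.dissipation
  obtain ⟨M, hM⟩ := StochHyp.exists_impulse_sq_bound (μ := fun k => ρ k + θ₂ * ν k) hT' hlam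
    (eventually_atTop.2 ⟨J, fun k hk => hJ k hk θ₁ hθ₁ θ₂ hθ₂⟩)
  refine ⟨?_, fun u u' x v x' v' hu hu' => ⟨fun t ht => ?_, fun k => ?_⟩, ?_⟩
  · have hosc := fun k => StochHyp.isDampedOscillator_regularNoise (T := T)
      (μ := ρ k + θ₂ * ν k) (lam := κ k + θ₁ * τ k) hF (hw.brownian k) (hw.adapted k)
    obtain ⟨u, hum, hu⟩ := StochHyp.exists_isMeanSquareSum_position hF hw hosc hj_HS hM
    exact ⟨u, _, _, ⟨hum, hosc, fun t ht =>
      StochHyp.tendstoInMeasure_of_isMeanSquareSum hF hw hosc hu ht⟩, hu⟩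
  · refine tendstoInMeasure_ae_unique (hu.expansion t ht)
      ((hu'.expansion t ht).congr_left fun n => ?_)
    -- There are countably many modes, so one null set serves them all. The partial sums then agree
    -- almost surely, and so do their limits in probability.
    have h : ∀ᵐ ω ∂P, ∀ k, x k t ω = x' k t ω := ae_all_iff.2 fun k =>
      (StochHyp.position_ae_eq hw hu.oscillator k ht).trans
        (StochHyp.position_ae_eq hw hu'.oscillator k ht).symm
    filter_upwards [h] with ω hω
    simp only [StochHyp.partialSum, hω]
  · filter_upwards [(hu.oscillator k).ae_eq (hw.brownian k),
      (hu'.oscillator k).ae_eq (hw.brownian k)] with ω h1 h2 t ht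
    rw [(h1 t ht).1, (h2 t ht).1]
  · rintro ⟨C₀, hC₀⟩ u x v hu
    obtain ⟨M', hM'⟩ := StochHyp.exists_impulseDeriv_sq_bound (T := T) hlam
      (μ := fun k => ρ k + θ₂ * ν k) fun k => (add_comm _ _).trans_le (hC₀ k)
    -- The given `u` is only known as a limit in probability. The mean-square sum `u₀` of the same
    -- coefficients is another such limit, so they agree almost surely and `u` inherits mean-square
    -- convergence.
    obtain ⟨u₀, -, hu₀⟩ := StochHyp.exists_isMeanSquareSum_position hF hw hu.oscillator hj_HS hM
    obtain ⟨y, hym, hy⟩ := StochHyp.exists_isMeanSquareSum_velocity hF hw hu.oscillator hj_HS hM'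
    have hae : ∀ t ≤ T, u₀ t =ᵐ[P] u t := fun t ht => tendstoInMeasure_ae_unique
      (StochHyp.tendstoInMeasure_of_isMeanSquareSum hF hw hu.oscillator hu₀ ht)
      (hu.expansion t ht)
    have hu₁ : StochHyp.IsMeanSquareSum P T (fun k => j (h k)) x u := fun t ht =>
      ⟨(hu₀ t ht).1.ae_eq (hae t ht), (hu₀ t ht).2.congr fun n =>
        eLpNorm_congr_ae ((hae t ht).mono fun ω hω => by simp only [hω])⟩
    exact ⟨y, hym, hy, StochHyp.isMeanSquareDeriv_of_isMeanSquareSum hF hw hu.oscillator hj_HS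
      hM' hu₁ hy⟩
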